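/- **Small-time approximate control of phases.** Let $\mathbb{T}=\mathbb{R}/2\pi\mathbb{Z}$, $\alpha\in\mathbb{R}$, $q\in\mathbb{N}$, and let $Q=(Q_0,\dots,Q_{q-1})\in C^\infty(\mathbb{T};\mathbb{R}^q)$ satisfy $$\{1,\sin x,\cos x,\sin 2x,\cos 2x\}\subset \mathrm{span}_{\mathbb{R}}\{Q_0,\dots,Q_{q-1}\}.$$ For a piecewise constant control $u:(0,T)\to\mathbb{R}^q$ and $\psi_0\in L^2(\mathbb{T};\mathbb{C})$, consider $$\partial_t\psi+\partial_x^3\psi-i\alpha\,\partial_x^2\psi=i\,(u(t)\cdot Q(x))\,\psi\ \text{ in }(0,T)\times\mathbb{T},\qquad \psi(0)=\psi_0,$$ whose solution is understood in the mild sense: $\psi\in C([0,T];L^2(\mathbb{T}))$ and, with $L=-\partial_x^3+i\alpha\partial_x^2$, $$\psi(t)=e^{tL}\psi_0+\int_0^t e^{(t-s)L}\,i\,(u(s)\cdot Q)\,\psi(s)\,ds,\qquad t\in[0,T].$$ Then for every $\psi_0\in L^2(\mathbb{T};\mathbb{C})$, every $\varepsilon>0$ and every $\theta\in C^\infty(\mathbb{T};\mathbb{R})$,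 there exist a time $T\in(0,\varepsilon)$ and a piecewise constant control $u:(0,T)\to\mathbb{R}^q$ such that the equation has a unique solution $\psi$ on $[0,T]$, and this solution satisfies $$\|\psi(T)-e^{i\theta}\psi_0\|_{L^2(\mathbb{T})}<\varepsilon.$$ -/

import Mathlib

noncomputable section

open MeasureTheory Complex
open scoped ContDiff

namespace KdVSch

/-- The torus `ℝ / 2πℤ`. -/
abbrev Torus : Type := AddCircle (2 * Real.pi)

instance fact_two_pi_pos : Fact (0 < 2 * Real.pi) := ⟨Real.two_pi_pos⟩

/-- The complex Hilbert space `L²(𝕋)`, for the translation-invariant probability measure. -/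
abbrev L2 : Type := Lp ℂ 2 (AddCircle.haarAddCircle : Measure Torus)

/-- `f` is a smooth function on the torus, i.e. its `2π`-periodic lift to `ℝ` is smooth. -/
def IsSmooth (f : C(Torus, ℝ)) : Prop := ContDiff ℝ ∞ (fun x : ℝ => f (x : Torus))

/-- The symbol of `L = -∂ₓ³ + iα ∂ₓ²`, i.e. `L e^{ikx} = airySymbol α k • e^{ikx}`. -/
def airySymbol (α : ℝ) (k : ℤ) : ℂ := -(I * k) ^ 3 + I * α * (I * k) ^ 2

lemma airySymbol_eq (α : ℝ) (k : ℤ) :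
    airySymbol α k = (((k : ℝ) ^ 3 - α * (k : ℝ) ^ 2 : ℝ) : ℂ) * I := by
  have h : I ^ 2 = -1 := I_sq
  unfold airySymbol
  push_cast
  linear_combination (-(I * (k : ℂ) ^ 3) + I * α * (k : ℂ) ^ 2) * h

lemma norm_exp_airySymbol (α t : ℝ) (k : ℤ) : ‖exp (t * airySymbol α k)‖ = 1 := by
  rw [airySymbol_eq, ← mul_assoc, ← ofReal_mul, norm_exp_ofReal_mul_I]

lemma memℓp_exp_airySymbol (α t : ℝ) (a : lp (fun _ : ℤ => ℂ) 2) :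
    Memℓp (fun k : ℤ => exp (t * airySymbol α k) * a k) 2 := by
  have h0 : 0 < (2 : ENNReal).toReal := by norm_num
  rw [memℓp_gen_iff h0]
  simpa only [norm_mul, norm_exp_airySymbol, one_mul] using (memℓp_gen_iff h0).1 (lp.memℓp a)

/-- The unitary group `e^{tL}` on `L²(𝕋)` generated by `L = -∂ₓ³ + iα ∂ₓ²`: it multiplies the
`k`-th Fourier coefficient by `exp (t * airySymbol α k)`. -/
def freeGroup (α t : ℝ) (f : L2) : L2 :=
  fourierBasis.repr.symm
    ⟨fun k : ℤ => exp (t * airySymbol α k) * fourierBasis.repr f k,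
      memℓp_exp_airySymbol α t (fourierBasis.repr f)⟩

lemma memLp_mul (g : C(Torus, ℂ)) (f : L2) :
    MemLp (fun x => g x * f x) 2 (AddCircle.haarAddCircle : Measure Torus) := by
  refine MemLp.of_le_mul (c := ‖g‖) (Lp.memLp f)
    (g.continuous.aestronglyMeasurable.mul (Lp.aestronglyMeasurable f)) ?_
  filter_upwards with x
  rw [norm_mul]
  exact mul_le_mul_of_nonneg_right (g.norm_coe_le_norm x) (norm_nonneg _)

/-- Pointwise multiplication of an element of `L²(𝕋)` by a continuous function. -/
def mulL2 (g : C(Torus, ℂ)) (f : L2) : L2 := (memLp_mul g f).toLp _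

/-- The function `i (v · Q)`. -/
def potential {q : ℕ} (Q : Fin q → C(Torus, ℝ)) (v : Fin q → ℝ) : C(Torus, ℂ) where
  toFun x := I * ((∑ j, v j * Q j x : ℝ) : ℂ)
  continuous_toFun := by fun_prop

/-- The function `e^{iθ}`. -/
def phase (θ : C(Torus, ℝ)) : C(Torus, ℂ) where
  toFun x := exp (I * (θ x : ℂ))
  continuous_toFun := by fun_prop

/-- `u ∈ PWC(0,T;ℝ^q)`: there is a subdivision `0 = t₀ < t₁ < ⋯ < tₙ = T` such that `u` is
constant on each open interval `(tᵢ, tᵢ₊₁)`. -/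
def IsPWC {q : ℕ} (T : ℝ) (u : ℝ → Fin q → ℝ) : Prop :=
  ∃ (n : ℕ) (t : ℕ → ℝ), t 0 = 0 ∧ t n = T ∧ (∀ i < n, t i < t (i + 1)) ∧
    ∀ i < n, ∃ c : Fin q → ℝ, ∀ s ∈ Set.Ioo (t i) (t (i + 1)), u s = c

/-- `ψ ∈ C([0,T]; L²(𝕋))` is the (mild) solution of
`∂ₜψ + ∂ₓ³ψ - iα ∂ₓ²ψ = i (u · Q) ψ`, `ψ(0) = ψ₀`, on `[0,T]`, i.e. it satisfies Duhamel's formula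
`ψ(t) = e^{tL} ψ₀ + ∫₀ᵗ e^{(t-s)L} (i (u(s) · Q) ψ(s)) ds`. For piecewise constant `u` and
continuous `ψ` the integrand is bounded and piecewise continuous. -/
def IsSolution {q : ℕ} (α : ℝ) (Q : Fin q → C(Torus, ℝ)) (T : ℝ) (u : ℝ → Fin q → ℝ)
    (ψ₀ : L2) (ψ : ℝ → L2) : Prop :=
  ContinuousOn ψ (Set.Icc 0 T) ∧
    ∀ t ∈ Set.Icc 0 T, ψ t = freeGroup α t ψ₀ +
      ∫ s in (0 : ℝ)..t, freeGroup α (t - s) (mulL2 (potential Q (u s)) (ψ s))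

end KdVSch

end

noncomputable section

open MeasureTheory Complex
open scoped ContDiff

namespace KdVSch

/-! ### The free group as a group of isometries -/

/-! Call a real function `φ` good if, for every real `c`, multiplication by `e^{icφ}` can be
approximated strongly in arbitrarily small time. The good functions form `phaseSpace`, a closed real
subspace of `C(𝕋)`: sums come from composing flows, limits from the continuity of `phase`. The
theorem says that this subspace is everything (`phaseSpace_eq_top`).

Two mechanisms produce good functions. Strong short controls: `v/δ` applied during a time `δ`
overwhelms the drift and gives `e^{i v·Q}` as `δ → 0` (`exists_norm_solution_sub_lt`), so the span
of `Q` is good. Conjugated drift: `e^{-iφ/μ} e^{μ³L} e^{iφ/μ}` is generated by `-(μ∂ + iφ')³ +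
iαμ(μ∂ + iφ')²`, which tends formally to `-(iφ')³ = iφ'³`; hence `φ'³` is good when `φ` is good and
`φ'` smooth (`exists_conj_lt`, `approx_phase_cube`).

Polarization turns cubes into products of three derivatives. Since differentiation exchanges `sin
kx` and `cos kx`, good modes at nonzero frequencies `a`, `b`, `c` yield the modes at `a + b + c`.
Starting from frequencies 0, 1, 2, the step `n + 1 = n + 2 - 1` reaches all of them, and
trigonometric polynomials are uniformly dense.

Solutions for constant controls come from Picard-Lindelöf in the interaction picture and are glued
by `IsSolution.concat`; uniqueness is Grönwall's inequality. -/

lemma repr_freeGroup (α t : ℝ) (f : L2) (k : ℤ) :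
    fourierBasis.repr (freeGroup α t f) k =
      exp (t * airySymbol α k) * fourierBasis.repr f k := by
  simp [freeGroup]

lemma L2.ext_repr {f g : L2} (h : ∀ k : ℤ, fourierBasis.repr f k = fourierBasis.repr g k) :
    f = g :=
  fourierBasis.repr.injective (lp.ext (funext h))

lemma freeGroup_add (α s t : ℝ) (f : L2) :
    freeGroup α (s + t) f = freeGroup α s (freeGroup α t f) := by
  refine L2.ext_repr fun k => ?_
  simp only [repr_freeGroup]
  push_cast
  rw [add_mul, exp_add]; ring

lemma freeGroup_zero (α : ℝ) (f : L2) : freeGroup α 0 f = f := by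
  refine L2.ext_repr fun k => ?_
  simp [repr_freeGroup]

lemma norm_freeGroup (α t : ℝ) (f : L2) : ‖freeGroup α t f‖ = ‖f‖ := by
  rw [← fourierBasis.repr.norm_map (freeGroup α t f), ← fourierBasis.repr.norm_map f]
  have h0 : 0 < (2 : ENNReal).toReal := by norm_num
  rw [lp.norm_eq_tsum_rpow h0, lp.norm_eq_tsum_rpow h0]
  simp only [repr_freeGroup, norm_mul, norm_exp_airySymbol, one_mul]

/-- The free group as linear isometric equivalences. -/
def freeIso (α t : ℝ) : L2 ≃ₗᵢ[ℂ] L2 where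
  toFun := freeGroup α t
  invFun := freeGroup α (-t)
  map_add' f g := by
    refine L2.ext_repr fun k => ?_
    simp only [repr_freeGroup, map_add, lp.coeFn_add, Pi.add_apply, mul_add]
  map_smul' c f := by
    refine L2.ext_repr fun k => ?_
    simp only [repr_freeGroup, map_smul, lp.coeFn_smul, Pi.smul_apply, smul_eq_mul,
      RingHom.id_apply]
    ring
  left_inv f := by rw [← freeGroup_add, neg_add_cancel, freeGroup_zero]
  right_inv f := by rw [← freeGroup_add, add_neg_cancel, freeGroup_zero]
  norm_map' f := norm_freeGroup α t f

@[simp] lemma freeIso_apply (α t : ℝ) (f : L2) : freeIso α t f = freeGroup α t f := rfl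

lemma freeGroup_sub (α t : ℝ) (f g : L2) :
    freeGroup α t (f - g) = freeGroup α t f - freeGroup α t g :=
  map_sub (freeIso α t) f g

lemma freeGroup_fourierLp (α t : ℝ) (k : ℤ) :
    freeGroup α t (fourierLp 2 k) = exp (t * airySymbol α k) • (fourierLp 2 k : L2) := by
  refine L2.ext_repr fun j => ?_
  rw [repr_freeGroup, map_smul, lp.coeFn_smul, Pi.smul_apply, smul_eq_mul]
  rw [← coe_fourierBasis, HilbertBasis.repr_self]
  by_cases h : j = k
  · subst h; rfl
  · simp [lp.single_apply, h]

/-- A closed subspace of `L²(𝕋)` containing the exponentials is everything. -/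
lemma L2.mem_of_fourier (S : Submodule ℂ L2) (hc : IsClosed (S : Set L2))
    (h : ∀ k : ℤ, (fourierLp 2 k : L2) ∈ S) (f : L2) : f ∈ S := by
  have h1 := span_fourierLp_closure_eq_top (T := 2 * Real.pi) (p := 2) (by simp)
  have h2 : (Submodule.span ℂ (Set.range (fourierLp (T := 2 * Real.pi) 2))).topologicalClosure
      ≤ S := by
    refine Submodule.topologicalClosure_minimal _ ?_ hc
    rw [Submodule.span_le]
    rintro _ ⟨k, rfl⟩
    exact h k
  rw [h1] at h2
  exact h2 trivial

/-- The vectors with a continuous orbit form a subspace, closed because the group is isometric and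
so orbits converge uniformly in time. It contains the Fourier modes, whose orbits are scalar
exponentials. -/
lemma continuous_freeGroup_apply (α : ℝ) (f : L2) : Continuous fun t => freeGroup α t f := by
  let S : Submodule ℂ L2 :=
    { carrier := {f | Continuous fun t => freeGroup α t f}
      add_mem' := fun {a b} ha hb => by
        have : (fun t => freeGroup α t (a + b)) =
            fun t => freeGroup α t a + freeGroup α t b :=
          funext fun t => map_add (freeIso α t) a b
        simp only [Set.mem_ofPred_eq, this]
        exact Continuous.add ha hb
      zero_mem' := by
        have : (fun t => freeGroup α t 0) = fun _ => 0 := funext fun t => map_zero (freeIso α t)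
        simp only [Set.mem_ofPred_eq, this]
        exact continuous_const
      smul_mem' := fun c a ha => by
        have : (fun t => freeGroup α t (c • a)) = fun t => c • freeGroup α t a :=
          funext fun t => map_smul (freeIso α t) c a
        simp only [Set.mem_ofPred_eq, this]
        exact Continuous.const_smul ha c }
  refine L2.mem_of_fourier S ?_ ?_ f
  · rw [← isSeqClosed_iff_isClosed]
    intro a b ha hab
    change Continuous fun t => freeGroup α t b
    refine TendstoUniformly.continuous (F := fun n t => freeGroup α t (a n)) (p := Filter.atTop)
      ?_ (Filter.Frequently.of_forall ha)
    rw [Metric.tendstoUniformly_iff]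
    intro ε hε
    filter_upwards [Metric.tendsto_nhds.1 hab ε hε] with n hn t
    rwa [dist_comm, ← freeIso_apply, ← freeIso_apply, (freeIso α t).dist_map]
  · intro k
    change Continuous fun t => freeGroup α t (fourierLp 2 k)
    simp only [freeGroup_fourierLp]
    fun_prop

lemma continuous_freeGroup (α : ℝ) : Continuous fun p : ℝ × L2 => freeGroup α p.1 p.2 := by
  rw [continuous_iff_continuousAt]
  rintro ⟨t, f⟩
  rw [ContinuousAt, tendsto_iff_norm_sub_tendsto_zero]
  have h1 : Filter.Tendsto
      (fun p : ℝ × L2 => ‖p.2 - f‖ + ‖freeGroup α p.1 f - freeGroup α t f‖)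
      (nhds (t, f)) (nhds 0) := by
    have : Continuous fun p : ℝ × L2 => ‖p.2 - f‖ + ‖freeGroup α p.1 f - freeGroup α t f‖ := by
      have := (continuous_freeGroup_apply α f).comp (continuous_fst (X := ℝ) (Y := L2))
      simp only [Function.comp_def] at this
      fun_prop
    simpa using this.tendsto (t, f)
  refine squeeze_zero (fun _ => norm_nonneg _) (fun p => ?_) h1
  calc ‖freeGroup α p.1 p.2 - freeGroup α t f‖
      = ‖freeGroup α p.1 (p.2 - f) + (freeGroup α p.1 f - freeGroup α t f)‖ := by
        rw [freeGroup_sub]; congr 1; abel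
    _ ≤ _ := by
        refine (norm_add_le _ _).trans ?_
        rw [norm_freeGroup]

/-! ### Multiplication operators -/

lemma coeFn_mulL2 (g : C(Torus, ℂ)) (f : L2) :
    mulL2 g f =ᵐ[AddCircle.haarAddCircle] fun x => g x * f x :=
  MemLp.coeFn_toLp _

lemma norm_mulL2_le (g : C(Torus, ℂ)) (f : L2) : ‖mulL2 g f‖ ≤ ‖g‖ * ‖f‖ := by
  refine Lp.norm_le_mul_norm_of_ae_le_mul ?_
  filter_upwards [coeFn_mulL2 g f] with x hx
  rw [hx, norm_mul]
  exact mul_le_mul_of_nonneg_right (g.norm_coe_le_norm x) (norm_nonneg _)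

/-- Multiplication, as a continuous bilinear map. -/
def mulOp : C(Torus, ℂ) →L[ℂ] L2 →L[ℂ] L2 :=
  LinearMap.mkContinuous₂
    (LinearMap.mk₂ ℂ mulL2
      (fun g₁ g₂ f => by
        refine Lp.ext ?_
        filter_upwards [coeFn_mulL2 (g₁ + g₂) f, coeFn_mulL2 g₁ f, coeFn_mulL2 g₂ f,
          Lp.coeFn_add (mulL2 g₁ f) (mulL2 g₂ f)] with x h1 h2 h3 h4
        rw [h1, h4, Pi.add_apply, h2, h3, ContinuousMap.add_apply, add_mul])
      (fun c g f => by
        refine Lp.ext ?_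
        filter_upwards [coeFn_mulL2 (c • g) f, coeFn_mulL2 g f,
          Lp.coeFn_smul c (mulL2 g f)] with x h1 h2 h4
        rw [h1, h4, Pi.smul_apply, h2, ContinuousMap.smul_apply, smul_mul_assoc])
      (fun g f₁ f₂ => by
        refine Lp.ext ?_
        filter_upwards [coeFn_mulL2 g (f₁ + f₂), coeFn_mulL2 g f₁, coeFn_mulL2 g f₂,
          Lp.coeFn_add (mulL2 g f₁) (mulL2 g f₂), Lp.coeFn_add f₁ f₂] with x h1 h2 h3 h4 h5
        rw [h1, h4, Pi.add_apply, h2, h3, h5, Pi.add_apply, mul_add])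
      (fun c g f => by
        refine Lp.ext ?_
        filter_upwards [coeFn_mulL2 g (c • f), coeFn_mulL2 g f,
          Lp.coeFn_smul c (mulL2 g f), Lp.coeFn_smul c f] with x h1 h2 h4 h5
        rw [h1, h4, Pi.smul_apply, h2, h5, Pi.smul_apply, mul_smul_comm]))
    1 (fun g f => by simpa using norm_mulL2_le g f)

@[simp] lemma mulOp_apply (g : C(Torus, ℂ)) (f : L2) : mulOp g f = mulL2 g f := rfl

lemma mulL2_mul (g₁ g₂ : C(Torus, ℂ)) (f : L2) :
    mulL2 (g₁ * g₂) f = mulL2 g₁ (mulL2 g₂ f) := by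
  refine Lp.ext ?_
  filter_upwards [coeFn_mulL2 (g₁ * g₂) f, coeFn_mulL2 g₁ (mulL2 g₂ f), coeFn_mulL2 g₂ f]
    with x h1 h2 h3
  rw [h1, h2, h3, ContinuousMap.mul_apply, mul_assoc]

lemma mulL2_one (f : L2) : mulL2 1 f = f := by
  refine Lp.ext ?_
  filter_upwards [coeFn_mulL2 1 f] with x h1
  rw [h1, ContinuousMap.one_apply, one_mul]

/-- The inclusion of continuous functions into `L²(𝕋)`. -/
abbrev toL2 : C(Torus, ℂ) →L[ℂ] L2 :=
  ContinuousMap.toLp (E := ℂ) 2 AddCircle.haarAddCircle ℂ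

lemma mulL2_toL2 (g h : C(Torus, ℂ)) : mulL2 g (toL2 h) = toL2 (g * h) := by
  refine Lp.ext ?_
  filter_upwards [coeFn_mulL2 g (toL2 h),
    ContinuousMap.coeFn_toLp (p := 2) (𝕜 := ℂ) AddCircle.haarAddCircle h,
    ContinuousMap.coeFn_toLp (p := 2) (𝕜 := ℂ) AddCircle.haarAddCircle (g * h)] with x h1 h2 h3
  rw [h1, h2, h3, ContinuousMap.mul_apply]

lemma norm_toL2_le (h : C(Torus, ℂ)) : ‖toL2 h‖ ≤ ‖h‖ := by
  -- Write `h = h * 1`; the constant 1 has norm at most 1 because the measure is a probability.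
  have h1 := norm_mulL2_le h (toL2 1)
  have h2 : ‖toL2 1‖ ≤ 1 := by
    refine (Lp.norm_le_of_ae_bound (C := 1) zero_le_one ?_).trans ?_
    · filter_upwards [ContinuousMap.coeFn_toLp (p := 2) (𝕜 := ℂ)
        (AddCircle.haarAddCircle : Measure Torus) (1 : C(Torus, ℂ))] with x h3
      rw [h3]; simp
    · simp [measureUnivNNReal]
  rw [mulL2_toL2, mul_one] at h1
  nlinarith [norm_nonneg h]

lemma norm_phase_le (θ : C(Torus, ℝ)) : ‖phase θ‖ ≤ 1 := by
  rw [ContinuousMap.norm_le _ zero_le_one]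
  intro x
  simp [phase, mul_comm I, norm_exp_ofReal_mul_I]

lemma phase_add (θ₁ θ₂ : C(Torus, ℝ)) : phase (θ₁ + θ₂) = phase θ₁ * phase θ₂ := by
  ext x
  simp [phase, mul_add, exp_add]

lemma phase_zero : phase 0 = 1 := by
  ext x
  simp [phase]

lemma norm_mulL2_phase_le (θ : C(Torus, ℝ)) (f : L2) : ‖mulL2 (phase θ) f‖ ≤ ‖f‖ :=
  (norm_mulL2_le _ _).trans (mul_le_of_le_one_left (norm_nonneg _) (norm_phase_le θ))

lemma mulL2_sub (g : C(Torus, ℂ)) (f₁ f₂ : L2) :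
    mulL2 g (f₁ - f₂) = mulL2 g f₁ - mulL2 g f₂ :=
  map_sub (mulOp g) f₁ f₂

lemma exp_apply (g : C(Torus, ℂ)) (x : Torus) : NormedSpace.exp g x = exp (g x) := by
  have := NormedSpace.map_exp (ContinuousMap.evalAlgHom ℂ ℂ x).toRingHom
    (continuous_eval_const x) g
  rw [Complex.exp_eq_exp_ℂ]
  exact this

/-- A real-valued function, seen as a complex-valued one. -/
def toC (φ : C(Torus, ℝ)) : C(Torus, ℂ) := ⟨fun x => (φ x : ℂ), by fun_prop⟩

@[simp] lemma toC_apply (φ : C(Torus, ℝ)) (x : Torus) : toC φ x = (φ x : ℂ) := rfl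

/-! ### Bounded measurable controls -/

/-- Measurable bounded controls. -/
def IsBddMeas {q : ℕ} (u : ℝ → Fin q → ℝ) : Prop :=
  Measurable u ∧ ∃ M : ℝ, ∀ s j, |u s j| ≤ M

lemma potential_eq_sum {q : ℕ} (Q : Fin q → C(Torus, ℝ)) (v : Fin q → ℝ) :
    potential Q v = ∑ j, (v j : ℂ) • (I • toC (Q j)) := by
  ext x
  simp [potential, ContinuousMap.sum_apply, Finset.mul_sum]
  refine Finset.sum_congr rfl fun j _ => by ring

lemma mulL2_potential {q : ℕ} (Q : Fin q → C(Torus, ℝ)) (v : Fin q → ℝ) (f : L2) :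
    mulL2 (potential Q v) f = ∑ j, (v j) • mulL2 (I • toC (Q j)) f := by
  rw [← mulOp_apply, potential_eq_sum, map_sum, sum_apply]
  refine Finset.sum_congr rfl fun j _ => ?_
  rw [map_smul, smul_apply, mulOp_apply]
  exact RCLike.real_smul_eq_coe_smul (K := ℂ) (v j) _ |>.symm

lemma IsBddMeas.potential_bound {q : ℕ} (Q : Fin q → C(Torus, ℝ)) {u : ℝ → Fin q → ℝ}
    (hu : IsBddMeas u) : ∃ K : ℝ, 0 ≤ K ∧ ∀ s, ‖potential Q (u s)‖ ≤ K := by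
  obtain ⟨-, M, hM⟩ := hu
  refine ⟨∑ j, |M| * ‖I • toC (Q j)‖, by positivity, fun s => ?_⟩
  rw [potential_eq_sum]
  refine (norm_sum_le _ _).trans (Finset.sum_le_sum fun j _ => ?_)
  rw [norm_smul, Complex.norm_real, Real.norm_eq_abs]
  exact mul_le_mul_of_nonneg_right ((hM s j).trans (le_abs_self M)) (norm_nonneg _)

/-- Linearity of the potential in the control writes the integrand as a finite sum of bounded
measurable scalars times continuous curves in `L²`. -/
lemma IsBddMeas.integrableOn {q : ℕ} (Q : Fin q → C(Torus, ℝ)) {u : ℝ → Fin q → ℝ}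
    (hu : IsBddMeas u) (α : ℝ) {T : ℝ} {r : ℝ → ℝ} (hr : Continuous r) {ψ : ℝ → L2}
    (hψ : ContinuousOn ψ (Set.Icc 0 T)) :
    IntegrableOn (fun s => freeGroup α (r s) (mulL2 (potential Q (u s)) (ψ s)))
      (Set.Icc 0 T) := by
  obtain ⟨hm, M, hM⟩ := hu
  have h1 : ∀ s, freeGroup α (r s) (mulL2 (potential Q (u s)) (ψ s)) =
      ∑ j, (u s j) • freeGroup α (r s) (mulL2 (I • toC (Q j)) (ψ s)) := by
    intro s
    rw [mulL2_potential, ← freeIso_apply, map_sum]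
    refine Finset.sum_congr rfl fun j _ => ?_
    exact ((freeIso α (r s)).toContinuousLinearEquiv.toContinuousLinearMap.restrictScalars
      ℝ).map_smul (u s j) _
  simp only [h1]
  refine integrable_finsetSum _ fun j _ => ?_
  have h2 : ContinuousOn (fun s => freeGroup α (r s) (mulL2 (I • toC (Q j)) (ψ s)))
      (Set.Icc 0 T) := by
    refine (continuous_freeGroup α).comp_continuousOn (f := fun s => (r s, _)) ?_
    exact hr.continuousOn.prodMk ((mulOp (I • toC (Q j))).continuous.comp_continuousOn hψ)
  exact Integrable.bdd_smul (φ := fun s => u s j) (h2.integrableOn_compact isCompact_Icc) M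
    ((measurable_pi_apply j).comp hm).aestronglyMeasurable
    (Filter.Eventually.of_forall fun s => hM s j)

lemma IsBddMeas.intervalIntegrable {q : ℕ} (Q : Fin q → C(Torus, ℝ)) {u : ℝ → Fin q → ℝ}
    (hu : IsBddMeas u) (α : ℝ) {T : ℝ} {r : ℝ → ℝ} (hr : Continuous r) {ψ : ℝ → L2}
    (hψ : ContinuousOn ψ (Set.Icc 0 T)) {a b : ℝ} (ha : a ∈ Set.Icc 0 T) (hb : b ∈ Set.Icc 0 T) :
    IntervalIntegrable (fun s => freeGroup α (r s) (mulL2 (potential Q (u s)) (ψ s)))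
      volume a b := by
  refine IntegrableOn.intervalIntegrable ((hu.integrableOn Q α hr hψ).mono_set ?_)
  exact Set.uIcc_subset_Icc ha hb

/-! ### Grönwall's inequality in integral form -/

lemma le_exp_of_le_integral {f : ℝ → ℝ} {T K η : ℝ} (hT : 0 ≤ T) (hK : 0 ≤ K)
    (hf : ContinuousOn f (Set.Icc 0 T)) (hf0 : ∀ t ∈ Set.Icc 0 T, 0 ≤ f t)
    (h : ∀ t ∈ Set.Icc 0 T, f t ≤ η + K * ∫ s in (0 : ℝ)..t, f s) {t : ℝ}
    (ht : t ∈ Set.Icc 0 T) : f t ≤ η * Real.exp (K * t) := by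
  -- Extending `f` by its end values makes the primitive differentiable on all of `ℝ`. The
  -- differential Grönwall inequality then applies to the right-hand side `G = η + K ∫ F`, since `G'
  -- = K F ≤ K G`.
  set F : ℝ → ℝ := Set.IccExtend hT (Set.domRestrict (Set.Icc 0 T) f) with hF
  have hFc : Continuous F := hf.domRestrict.Icc_extend'
  have hFf : ∀ s ∈ Set.Icc 0 T, F s = f s := fun s hs => by
    rw [hF, Set.IccExtend_of_mem _ _ hs]; rfl
  have hint : ∀ s ∈ Set.Icc 0 T, ∫ r in (0 : ℝ)..s, f r = ∫ r in (0 : ℝ)..s, F r := by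
    intro s hs
    refine intervalIntegral.integral_congr fun r hr => ?_
    rw [Set.uIcc_of_le hs.1] at hr
    exact (hFf r ⟨hr.1, hr.2.trans hs.2⟩).symm
  have hder : ∀ s, HasDerivAt (fun t => η + K * ∫ r in (0 : ℝ)..t, F r) (K * F s) s := fun s =>
    ((intervalIntegral.integral_hasDerivAt_right (hFc.intervalIntegrable _ _)
      hFc.stronglyMeasurable.stronglyMeasurableAtFilter hFc.continuousAt).const_mul K).const_add η
  have hη : 0 ≤ η := by
    have := h 0 ⟨le_rfl, hT⟩
    simp only [intervalIntegral.integral_same, mul_zero, add_zero] at this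
    exact (hf0 0 ⟨le_rfl, hT⟩).trans this
  have hnn : ∀ s ∈ Set.Icc 0 T, 0 ≤ ∫ r in (0 : ℝ)..s, F r := fun s hs =>
    intervalIntegral.integral_nonneg hs.1 fun r hr => by
      rw [hFf r ⟨hr.1, hr.2.trans hs.2⟩]; exact hf0 r ⟨hr.1, hr.2.trans hs.2⟩
  have key := norm_le_gronwallBound_of_norm_deriv_right_le (δ := η) (K := K) (ε := 0)
    (a := 0) (b := T) (f := fun t => η + K * ∫ r in (0 : ℝ)..t, F r) (f' := fun s => K * F s)
    (fun s _ => (hder s).continuousAt.continuousWithinAt)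
    (fun s _ => (hder s).hasDerivWithinAt) (by simp [abs_of_nonneg hη]) (fun s hs => by
      have hs' : s ∈ Set.Icc 0 T := ⟨hs.1, hs.2.le⟩
      have h1 := h s hs'
      rw [hint s hs', ← hFf s hs'] at h1
      have h2 : 0 ≤ F s := by rw [hFf s hs']; exact hf0 s hs'
      rw [Real.norm_of_nonneg (mul_nonneg hK h2),
        Real.norm_of_nonneg (add_nonneg hη (mul_nonneg hK (hnn s hs'))), add_zero]
      exact mul_le_mul_of_nonneg_left h1 hK) t ht
  rw [gronwallBound_ε0, sub_zero, Real.norm_of_nonneg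
    (add_nonneg hη (mul_nonneg hK (hnn t ht))), ← hint t ht] at key
  exact (h t ht).trans key

lemma norm_integral_freeGroup_mulL2_le {α K t : ℝ} (ht : 0 ≤ t) {g : ℝ → C(Torus, ℂ)}
    (hg : ∀ s, ‖g s‖ ≤ K) {r : ℝ → ℝ} {d : ℝ → L2} (hd : ContinuousOn d (Set.Icc 0 t)) :
    ‖∫ s in (0 : ℝ)..t, freeGroup α (r s) (mulL2 (g s) (d s))‖ ≤
      K * ∫ s in (0 : ℝ)..t, ‖d s‖ := by
  rw [← intervalIntegral.integral_const_mul]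
  refine intervalIntegral.norm_integral_le_of_norm_le ht
    (Filter.Eventually.of_forall fun s _ => ?_) ?_
  · rw [norm_freeGroup]
    exact (norm_mulL2_le _ _).trans (mul_le_mul_of_nonneg_right (hg s) (norm_nonneg _))
  · refine ContinuousOn.intervalIntegrable ?_
    rw [Set.uIcc_of_le ht]
    exact continuousOn_const.mul hd.norm

/-- The free terms cancel in the difference of two Duhamel formulas, which leaves Grönwall with `η =
0`. -/
lemma IsSolution.eqOn {q : ℕ} {α : ℝ} {Q : Fin q → C(Torus, ℝ)} {T : ℝ} {u : ℝ → Fin q → ℝ}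
    (hu : IsBddMeas u) {ψ₀ : L2} {ψ χ : ℝ → L2} (hψ : IsSolution α Q T u ψ₀ ψ)
    (hχ : IsSolution α Q T u ψ₀ χ) : Set.EqOn χ ψ (Set.Icc 0 T) := by
  obtain ⟨K, hK0, hK⟩ := hu.potential_bound Q
  intro t ht
  have hT : 0 ≤ T := ht.1.trans ht.2
  have key := le_exp_of_le_integral (f := fun t => ‖χ t - ψ t‖) (η := 0) hT hK0
    (hχ.1.sub hψ.1).norm (fun _ _ => norm_nonneg _) (fun t ht => ?_) ht
  · rw [zero_mul] at key
    exact sub_eq_zero.1 (norm_le_zero_iff.1 key)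
  · have h0 : (0 : ℝ) ∈ Set.Icc 0 T := ⟨le_rfl, hT⟩
    rw [hχ.2 t ht, hψ.2 t ht, add_sub_add_left_eq_sub, ← intervalIntegral.integral_sub
      (hu.intervalIntegrable Q α (by fun_prop) hχ.1 h0 ht)
      (hu.intervalIntegrable Q α (by fun_prop) hψ.1 h0 ht), zero_add]
    simp only [← freeGroup_sub, ← mulL2_sub]
    exact norm_integral_freeGroup_mulL2_le ht.1 hK
      ((hχ.1.sub hψ.1).mono (Set.Icc_subset_Icc_right ht.2))

/-! ### Concatenation -/

/-- Follow `f` up to time `T`, then `g`. -/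
def concat {β : Type*} (T : ℝ) (f g : ℝ → β) (s : ℝ) : β := if s ≤ T then f s else g (s - T)

lemma IsBddMeas.concat {q : ℕ} {u₁ u₂ : ℝ → Fin q → ℝ} (h₁ : IsBddMeas u₁)
    (h₂ : IsBddMeas u₂) (T : ℝ) : IsBddMeas (concat T u₁ u₂) := by
  obtain ⟨hm₁, M₁, hM₁⟩ := h₁
  obtain ⟨hm₂, M₂, hM₂⟩ := h₂
  refine ⟨Measurable.ite measurableSet_Iic hm₁ (hm₂.comp (by fun_prop)), max M₁ M₂,
    fun s j => ?_⟩
  unfold KdVSch.concat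
  split_ifs
  · exact (hM₁ _ _).trans (le_max_left _ _)
  · exact (hM₂ _ _).trans (le_max_right _ _)

lemma freeIso_intervalIntegral (α t a b : ℝ) (f : ℝ → L2) :
    freeGroup α t (∫ s in a..b, f s) = ∫ s in a..b, freeGroup α t (f s) := by
  have := fun s : Set ℝ => (freeIso α t).toContinuousLinearEquiv.integral_comp_comm
    (μ := volume.restrict s) f
  simp only [LinearIsometryEquiv.coe_toContinuousLinearEquiv, freeIso_apply] at this
  rw [intervalIntegral, intervalIntegral, freeGroup_sub, this, this]

/-- Past `T₁` the Duhamel integral splits at `T₁`: the group law carries `e^{(t-T₁)L}` into the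
first part, and a translation of time identifies the second. -/
lemma IsSolution.concat {q : ℕ} {α : ℝ} {Q : Fin q → C(Torus, ℝ)} {T₁ T₂ : ℝ}
    (hT₁ : 0 ≤ T₁) {u₁ u₂ : ℝ → Fin q → ℝ} (hu₁ : IsBddMeas u₁)
    (hu₂ : IsBddMeas u₂) {ψ₀ : L2} {ψ χ : ℝ → L2} (hψ : IsSolution α Q T₁ u₁ ψ₀ ψ)
    (hχ : IsSolution α Q T₂ u₂ (ψ T₁) χ) :
    IsSolution α Q (T₁ + T₂) (concat T₁ u₁ u₂) ψ₀ (concat T₁ ψ χ) := by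
  -- For negative `T₂` the whole interval lies before `T₁` and the second piece plays no role.
  rcases lt_or_ge T₂ 0 with hT₂ | hT₂
  · have hle : ∀ s ∈ Set.Icc 0 (T₁ + T₂), s ≤ T₁ := fun s hs => hs.2.trans (by linarith)
    refine ⟨(hψ.1.mono (Set.Icc_subset_Icc_right (by linarith))).congr fun s hs =>
      if_pos (hle s hs), fun t ht => ?_⟩
    rw [KdVSch.concat, if_pos (hle t ht), hψ.2 t ⟨ht.1, hle t ht⟩]
    congr 1
    refine intervalIntegral.integral_congr fun s hs => ?_
    rw [Set.uIcc_of_le ht.1] at hs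
    simp only [KdVSch.concat, if_pos (hs.2.trans (hle t ht))]
  have hχ0 : χ 0 = ψ T₁ := by
    have := hχ.2 0 ⟨le_rfl, hT₂⟩
    rwa [intervalIntegral.integral_same, add_zero, freeGroup_zero] at this
  have hfirst : ∀ s ≤ T₁, KdVSch.concat T₁ ψ χ s = ψ s := fun s hs => if_pos hs
  have hsecond : ∀ s, T₁ ≤ s → KdVSch.concat T₁ ψ χ s = χ (s - T₁) := by
    intro s hs
    rcases hs.eq_or_lt with rfl | hs
    · rw [hfirst _ le_rfl, sub_self, hχ0]
    · exact if_neg hs.not_ge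
  have hc : ContinuousOn (KdVSch.concat T₁ ψ χ) (Set.Icc 0 (T₁ + T₂)) := by
    have h1 : ContinuousOn (KdVSch.concat T₁ ψ χ) (Set.Icc 0 T₁) :=
      hψ.1.congr fun s hs => hfirst s hs.2
    have h2 : ContinuousOn (KdVSch.concat T₁ ψ χ) (Set.Icc T₁ (T₁ + T₂)) := by
      refine ContinuousOn.congr (f := fun s => χ (s - T₁)) ?_ fun s hs => hsecond s hs.1
      refine hχ.1.comp (by fun_prop) fun s hs => ?_
      exact ⟨by linarith [hs.1], by linarith [hs.2]⟩
    have := h1.union_of_isClosed h2 isClosed_Icc isClosed_Icc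
    rwa [Set.Icc_union_Icc_eq_Icc hT₁ (by linarith)] at this
  refine ⟨hc, fun t ht => ?_⟩
  have hfi : ∀ t s, s ≤ T₁ →
      freeGroup α (t - s) (mulL2 (potential Q (KdVSch.concat T₁ u₁ u₂ s))
        (KdVSch.concat T₁ ψ χ s)) = freeGroup α (t - s) (mulL2 (potential Q (u₁ s)) (ψ s)) := by
    intro t s hs
    rw [hfirst s hs, KdVSch.concat, if_pos hs]
  rcases le_total t T₁ with h | h
  · rw [hfirst t h, hψ.2 t ⟨ht.1, h⟩]
    congr 1
    refine intervalIntegral.integral_congr fun s hs => ?_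
    rw [Set.uIcc_of_le ht.1] at hs
    exact (hfi t s (hs.2.trans h)).symm
  · have hmem : T₁ ∈ Set.Icc 0 (T₁ + T₂) := ⟨hT₁, by linarith⟩
    have hmem0 : (0 : ℝ) ∈ Set.Icc 0 (T₁ + T₂) := ⟨le_rfl, by linarith⟩
    have hu := hu₁.concat hu₂ T₁
    rw [← intervalIntegral.integral_add_adjacent_intervals
      (hu.intervalIntegrable Q α (r := fun s => t - s) (by fun_prop) hc hmem0 hmem)
      (hu.intervalIntegrable Q α (r := fun s => t - s) (by fun_prop) hc hmem ht), hsecond t h,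
      hχ.2 (t - T₁) ⟨by linarith, by linarith [ht.2]⟩, hψ.2 T₁ ⟨hT₁, le_rfl⟩, ← add_assoc]
    congr 1
    · rw [← freeIso_apply, map_add, freeIso_apply, freeIso_apply, ← freeGroup_add,
        sub_add_cancel, freeIso_intervalIntegral]
      congr 1
      refine intervalIntegral.integral_congr fun s hs => ?_
      rw [Set.uIcc_of_le hT₁] at hs
      simp only [hfi t s hs.2, ← freeGroup_add, sub_add_sub_cancel]
    · have : ∫ s in (0 : ℝ)..(t - T₁), freeGroup α (t - T₁ - s)
          (mulL2 (potential Q (u₂ s)) (χ s)) = ∫ s in (T₁ - T₁)..(t - T₁),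
          freeGroup α (t - T₁ - s) (mulL2 (potential Q (u₂ s)) (χ s)) := by rw [sub_self]
      rw [this, ← intervalIntegral.integral_comp_sub_right (fun s => freeGroup α (t - T₁ - s)
          (mulL2 (potential Q (u₂ s)) (χ s))) T₁]
      -- At `s = T₁` the glued control still takes the value of `u₁`, so the integrands are compared
      -- only on `(T₁, t]`.
      refine intervalIntegral.integral_congr_ae (Filter.Eventually.of_forall fun s hs => ?_)
      rw [Set.uIoc_of_le h] at hs
      rw [hsecond s hs.1.le, KdVSch.concat, if_neg hs.1.not_ge, sub_sub_sub_cancel_right]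

lemma IsPWC.concat {q : ℕ} {T₁ T₂ : ℝ} {u₁ u₂ : ℝ → Fin q → ℝ} (h₁ : IsPWC T₁ u₁)
    (h₂ : IsPWC T₂ u₂) : IsPWC (T₁ + T₂) (concat T₁ u₁ u₂) := by
  obtain ⟨n₁, t₁, ht₁0, ht₁n, hmono₁, hc₁⟩ := h₁
  obtain ⟨n₂, t₂, ht₂0, ht₂n, hmono₂, hc₂⟩ := h₂
  have hle₁ : ∀ i ≤ n₁, t₁ i ≤ T₁ := by
    intro i hi
    rw [← ht₁n]
    refine Nat.decreasingInduction (motive := fun k _ => t₁ k ≤ t₁ n₁)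
      (fun k hk ih => (hmono₁ k hk).le.trans ih) le_rfl hi
  have hge₂ : ∀ i ≤ n₂, 0 ≤ t₂ i := by
    intro i hi
    induction i with
    | zero => exact ht₂0.ge
    | succ i ih => exact (ih (by omega)).trans (hmono₂ i (by omega)).le
  obtain ⟨t, hfirst, hsecond⟩ : ∃ t : ℕ → ℝ, (∀ i ≤ n₁, t i = t₁ i) ∧
      ∀ i, n₁ ≤ i → t i = T₁ + t₂ (i - n₁) := by
    refine ⟨fun i => if i ≤ n₁ then t₁ i else T₁ + t₂ (i - n₁), fun i hi => if_pos hi,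
      fun i hi => ?_⟩
    dsimp only
    split_ifs with h
    · obtain rfl : i = n₁ := le_antisymm h hi
      rw [ht₁n, Nat.sub_self, ht₂0, add_zero]
    · rfl
  refine ⟨n₁ + n₂, t, by rw [hfirst 0 (Nat.zero_le _), ht₁0], ?_, fun i hi => ?_, fun i hi => ?_⟩
  · rw [hsecond (n₁ + n₂) (by omega), Nat.add_sub_cancel_left, ht₂n]
  · rcases lt_or_ge i n₁ with h | h
    · rw [hfirst i h.le, hfirst (i + 1) h]
      exact hmono₁ i h
    · rw [hsecond i h, hsecond (i + 1) (by omega), Nat.sub_add_comm h]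
      have := hmono₂ (i - n₁) (by omega)
      linarith
  · rcases lt_or_ge i n₁ with h | h
    · obtain ⟨c, hc⟩ := hc₁ i h
      refine ⟨c, fun s hs => ?_⟩
      rw [hfirst i h.le, hfirst (i + 1) h] at hs
      rw [KdVSch.concat, if_pos (hs.2.le.trans (hle₁ _ h)), hc s hs]
    · obtain ⟨c, hc⟩ := hc₂ (i - n₁) (by omega)
      refine ⟨c, fun s hs => ?_⟩
      rw [hsecond i h, hsecond (i + 1) (by omega), Nat.sub_add_comm h] at hs
      have := hge₂ (i - n₁) (by omega)
      rw [KdVSch.concat, if_neg (by linarith [hs.1]),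
        hc _ ⟨by linarith [hs.1], by linarith [hs.2]⟩]

/-! ### Constant controls -/

lemma isBddMeas_const {q : ℕ} (v : Fin q → ℝ) : IsBddMeas fun _ => v :=
  ⟨measurable_const, ‖v‖, fun _ j => norm_le_pi_norm v j⟩

lemma isPWC_const {q : ℕ} {T : ℝ} (hT : 0 < T) (v : Fin q → ℝ) : IsPWC T fun _ => v := by
  refine ⟨1, fun i => i * T, by simp, by simp, fun i _ => ?_, fun i _ => ⟨v, fun _ _ => rfl⟩⟩
  push_cast
  linarith

/-- In the interaction picture `φ(t) = e^{-tL} ψ(t)` the unbounded `L` disappears: `φ' = e^{-tL} B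
e^{tL} φ` is an ODE with a Lipschitz right-hand side, continuous in time. -/
lemma exists_isSolution_const_of_small {q : ℕ} (α : ℝ) (Q : Fin q → C(Torus, ℝ))
    (v : Fin q → ℝ) {h : ℝ} (hh : 0 ≤ h) (hsmall : ‖potential Q v‖ * h ≤ 1 / 2) (ψ₀ : L2) :
    ∃ ψ, IsSolution α Q h (fun _ => v) ψ₀ ψ := by
  set B : L2 → L2 := mulL2 (potential Q v)
  have hBc : Continuous B := (mulOp (potential Q v)).continuous
  have hcont : Continuous fun p : ℝ × L2 =>
      freeGroup α (-p.1) (B (freeGroup α p.1 p.2)) := by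
    have h1 : Continuous fun p : ℝ × L2 => B (freeGroup α p.1 p.2) :=
      hBc.comp (continuous_freeGroup α)
    exact (continuous_freeGroup α).comp (f := fun p : ℝ × L2 => (-p.1, B (freeGroup α p.1 p.2)))
      (continuous_fst.neg.prodMk h1)
  -- On the ball of radius `‖ψ₀‖` about `ψ₀` the field is at most `2 ‖potential Q v‖ ‖ψ₀‖`. Staying
  -- in the ball up to time `h` is exactly what the smallness hypothesis gives.
  have hPL : IsPicardLindelof (fun t x => freeGroup α (-t) (B (freeGroup α t x)))
      (tmin := 0) (tmax := h) ⟨0, le_rfl, hh⟩ ψ₀ ‖ψ₀‖₊ 0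
      (‖potential Q v‖₊ * (2 * ‖ψ₀‖₊)) ‖potential Q v‖₊ := by
    refine ⟨fun t _ => ?_, fun x _ => ?_, fun t _ x hx => ?_, ?_⟩
    · refine (LipschitzWith.of_dist_le_mul fun x y => ?_).lipschitzOnWith
      rw [dist_eq_norm, dist_eq_norm, ← freeGroup_sub, norm_freeGroup, ← mulL2_sub,
        ← freeGroup_sub]
      exact (norm_mulL2_le _ _).trans_eq (by rw [norm_freeGroup]; rfl)
    · exact (hcont.comp (by fun_prop : Continuous fun t : ℝ => (t, x))).continuousOn
    · rw [norm_freeGroup]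
      refine (norm_mulL2_le _ _).trans ?_
      rw [norm_freeGroup]
      push_cast
      refine mul_le_mul_of_nonneg_left ?_ (norm_nonneg _)
      rw [mem_closedBall_iff_norm] at hx
      have := norm_le_norm_add_norm_sub ψ₀ x
      rw [norm_sub_rev] at this
      simp only [coe_nnnorm] at hx
      linarith
    · simp only [sub_zero, sub_self, NNReal.coe_mul, coe_nnnorm, NNReal.coe_ofNat,
        NNReal.coe_zero, max_eq_left hh]
      nlinarith [norm_nonneg ψ₀]
  obtain ⟨φ, hφ0, hφ⟩ := hPL.exists_eq_forall_mem_Icc_hasDerivWithinAt₀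
  simp only at hφ0
  have hφc : ContinuousOn φ (Set.Icc 0 h) := fun t ht => (hφ t ht).continuousWithinAt
  have hψc : ContinuousOn (fun t => freeGroup α t (φ t)) (Set.Icc 0 h) :=
    (continuous_freeGroup α).comp_continuousOn (f := fun s => (s, φ s))
      (continuousOn_id.prodMk hφc)
  refine ⟨fun t => freeGroup α t (φ t), hψc, fun t ht => ?_⟩
  have hFTC := intervalIntegral.integral_eq_sub_of_hasDerivAt_of_le ht.1
    (hφc.mono (Set.Icc_subset_Icc_right ht.2))
    (fun s hs => (hφ s ⟨hs.1.le, hs.2.le.trans ht.2⟩).hasDerivAt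
      (Icc_mem_nhds hs.1 (hs.2.trans_le ht.2)))
    ((isBddMeas_const v).intervalIntegrable Q α (r := fun s => -s) continuous_neg hψc
      ⟨le_rfl, hh⟩ ht)
  rw [hφ0] at hFTC
  have : φ t = ψ₀ + ∫ s in (0 : ℝ)..t, freeGroup α (-s) (B (freeGroup α s (φ s))) := by
    rw [hFTC]; abel
  simp only
  conv_lhs => rw [this]
  rw [← freeIso_apply, map_add, freeIso_apply, freeIso_apply, freeIso_intervalIntegral]
  simp only [← freeGroup_add, sub_eq_add_neg]
  rfl

/-- The admissible step length does not depend on the initial state, so equal short steps can be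
concatenated. -/
lemma exists_isSolution_const {q : ℕ} (α : ℝ) (Q : Fin q → C(Torus, ℝ))
    (v : Fin q → ℝ) {T : ℝ} (hT : 0 ≤ T) (ψ₀ : L2) :
    ∃ ψ, IsSolution α Q T (fun _ => v) ψ₀ ψ := by
  obtain ⟨n, hn⟩ := exists_nat_gt (2 * (‖potential Q v‖ * T))
  have hn0 : (0 : ℝ) < n := lt_of_le_of_lt (by positivity) hn
  have hTn : 0 ≤ T / n := by positivity
  have key : ∀ m : ℕ, ∀ ψ₀, ∃ ψ, IsSolution α Q (m * (T / n)) (fun _ => v) ψ₀ ψ := by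
    intro m
    induction m with
    | zero =>
      intro ψ₀
      exact exists_isSolution_const_of_small α Q v (by simp) (by simp) ψ₀
    | succ m ih =>
      intro ψ₀
      obtain ⟨ψ, hψ⟩ := ih ψ₀
      obtain ⟨χ, hχ⟩ := exists_isSolution_const_of_small α Q v hTn
        (by rw [mul_div_assoc', div_le_iff₀ hn0]; linarith) (ψ (m * (T / n)))
      have := hψ.concat (by positivity) (isBddMeas_const v) (isBddMeas_const v) hχ
      refine ⟨KdVSch.concat (m * (T / n)) ψ χ, ?_⟩
      convert this using 1
      · push_cast; ring
      · funext s; simp [KdVSch.concat]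
  have := key n ψ₀
  rwa [mul_div_cancel₀ _ hn0.ne'] at this

/-! ### Reachability -/

/-- The state `ψ₁` is reached from `ψ₀` at time `T` with a piecewise constant control. -/
def Reach {q : ℕ} (α : ℝ) (Q : Fin q → C(Torus, ℝ)) (T : ℝ) (ψ₀ ψ₁ : L2) : Prop :=
  -- `IsPWC` leaves `u` arbitrary outside the open pieces, so bounded measurability on the whole
  -- line is required separately.
  ∃ u : ℝ → Fin q → ℝ, IsPWC T u ∧ IsBddMeas u ∧
    ∃ ψ : ℝ → L2, IsSolution α Q T u ψ₀ ψ ∧ ψ T = ψ₁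

lemma Reach.trans {q : ℕ} {α : ℝ} {Q : Fin q → C(Torus, ℝ)} {T₁ T₂ : ℝ} (hT₁ : 0 ≤ T₁)
    (hT₂ : 0 < T₂) {ψ₀ ψ₁ ψ₂ : L2} (h₁ : Reach α Q T₁ ψ₀ ψ₁) (h₂ : Reach α Q T₂ ψ₁ ψ₂) :
    Reach α Q (T₁ + T₂) ψ₀ ψ₂ := by
  obtain ⟨u₁, hp₁, hb₁, ψ, hψ, rfl⟩ := h₁
  obtain ⟨u₂, hp₂, hb₂, χ, hχ, rfl⟩ := h₂
  refine ⟨_, hp₁.concat hp₂, hb₁.concat hb₂ T₁, _, hψ.concat hT₁ hb₁ hb₂ hχ, ?_⟩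
  rw [concat, if_neg (by linarith), add_sub_cancel_left]

lemma Reach.free {q : ℕ} (α : ℝ) (Q : Fin q → C(Torus, ℝ)) {T : ℝ} (hT : 0 < T) (ψ₀ : L2) :
    Reach α Q T ψ₀ (freeGroup α T ψ₀) := by
  refine ⟨_, isPWC_const hT 0, isBddMeas_const 0, fun t => freeGroup α t ψ₀,
    ⟨(continuous_freeGroup_apply α ψ₀).continuousOn, fun t _ => ?_⟩, rfl⟩
  have h1 : potential Q 0 = 0 := by rw [potential_eq_sum]; simp
  have h2 : ∀ s f, freeGroup α s (mulL2 0 f) = 0 := fun s f => by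
    rw [← mulOp_apply, map_zero]; exact map_zero (freeIso α s)
  simp only [h1, h2, intervalIntegral.integral_zero, add_zero]

/-! ### Strong controls -/

/-- Tube lemma: compactness of `[0,1]` makes the smallness near `μ = 0` uniform in `τ`. -/
lemma exists_uniform_small {E : Type*} [NormedAddCommGroup E] {f : ℝ × ℝ → E}
    (hf : Continuous f) (h0 : ∀ τ, f (0, τ) = 0) {η : ℝ} (hη : 0 < η) :
    ∃ δ > 0, ∀ μ : ℝ, |μ| < δ → ∀ τ ∈ Set.Icc (0 : ℝ) 1, ‖f (μ, τ)‖ < η := by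
  have h1 : ∀ᶠ μ in nhds (0 : ℝ), ∀ τ ∈ Set.Icc (0 : ℝ) 1, ‖f (μ, τ)‖ < η := by
    refine isCompact_Icc.eventually_forall_of_forall_eventually fun τ _ => ?_
    refine hf.norm.continuousAt.eventually_lt continuousAt_const ?_
    simpa [h0] using hη
  obtain ⟨δ, hδ, h⟩ := Metric.eventually_nhds_iff.1 h1
  exact ⟨δ, hδ, fun μ hμ => h (by simpa using hμ)⟩

lemma hasDerivAt_mulL2_exp (P : C(Torus, ℂ)) (f : L2) (t : ℝ) :
    HasDerivAt (fun s : ℝ => mulL2 (NormedSpace.exp (s • P)) f)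
      (mulL2 P (mulL2 (NormedSpace.exp (t • P)) f)) t := by
  have h1 := hasDerivAt_exp_smul_const' (𝕂 := ℝ) P t
  have h2 := (((mulOp.flip f).restrictScalars ℝ).hasFDerivAt (x := NormedSpace.exp
    (t • P))).comp_hasDerivAt t h1
  simp only [Function.comp_def, ContinuousLinearMap.coe_restrictScalars',
    ContinuousLinearMap.flip_apply, mulOp_apply, mulL2_mul] at h2
  exact h2

lemma potential_smul {q : ℕ} (Q : Fin q → C(Torus, ℝ)) (c : ℝ) (v : Fin q → ℝ) :
    potential Q (c • v) = c • potential Q v := by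
  ext x
  simp [potential, Finset.mul_sum, mul_assoc, mul_left_comm I]

/-- The impulse `δ · δ⁻¹v = v` is independent of `δ`, while the drift acts only for the time `δ`.
The comparison curve `y(t) = z(t/δ)` solves the equation without drift. Grönwall's rate `‖P‖/δ` over
the time `δ` costs only the factor `e^{‖P‖}`. -/
lemma exists_norm_solution_sub_lt {q : ℕ} (α : ℝ) (Q : Fin q → C(Torus, ℝ)) (v : Fin q → ℝ)
    (ψ₀ : L2) {ε : ℝ} (hε : 0 < ε) : ∃ δ₀ > 0, ∀ δ : ℝ, 0 < δ → δ < δ₀ → ∀ ψ,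
      IsSolution α Q δ (fun _ => δ⁻¹ • v) ψ₀ ψ →
        ‖ψ δ - mulL2 (NormedSpace.exp (potential Q v)) ψ₀‖ < ε := by
  set P := potential Q v with hP
  set z : ℝ → L2 := fun s => mulL2 (NormedSpace.exp (s • P)) ψ₀ with hz
  have hz' : ∀ s, HasDerivAt z (mulL2 P (z s)) s := hasDerivAt_mulL2_exp P ψ₀
  have hzc : Continuous z := continuous_iff_continuousAt.2 fun s => (hz' s).continuousAt
  have hPz : Continuous fun s => mulL2 P (z s) := (mulOp P).continuous.comp hzc
  set η := ε / (4 * Real.exp ‖P‖) with hη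
  have hη0 : 0 < η := by positivity
  obtain ⟨δ₁, hδ₁, h₁⟩ := exists_uniform_small
    (f := fun p : ℝ × ℝ => freeGroup α p.1 ψ₀ - ψ₀)
    (((continuous_freeGroup_apply α ψ₀).comp continuous_fst).sub continuous_const)
    (fun _ => by simp [freeGroup_zero]) hη0
  obtain ⟨δ₂, hδ₂, h₂⟩ := exists_uniform_small
    (f := fun p : ℝ × ℝ => freeGroup α p.1 (mulL2 P (z p.2)) - mulL2 P (z p.2))
    (((continuous_freeGroup α).comp (f := fun p : ℝ × ℝ => (p.1, mulL2 P (z p.2)))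
      (continuous_fst.prodMk (hPz.comp continuous_snd))).sub (hPz.comp continuous_snd))
    (fun _ => by simp [freeGroup_zero]) hη0
  refine ⟨min δ₁ δ₂, lt_min hδ₁ hδ₂, fun δ hδ hδlt ψ hψ => ?_⟩
  have hlt₁ := hδlt.trans_le (min_le_left _ _)
  have hlt₂ := hδlt.trans_le (min_le_right _ _)
  set y : ℝ → L2 := fun t => z (δ⁻¹ * t) with hy
  have hyc : Continuous y := hzc.comp (by fun_prop)
  have hPy : Continuous fun s => mulL2 P (y s) := (mulOp P).continuous.comp hyc
  have hPyc : Continuous fun s => δ⁻¹ • mulL2 P (y s) := hPy.const_smul δ⁻¹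
  have hsm : ∀ f, mulL2 (potential Q (δ⁻¹ • v)) f = δ⁻¹ • mulL2 P f := fun f => by
    rw [potential_smul, ← mulOp_apply, ← hP]
    exact congrArg (fun g : L2 →L[ℂ] L2 => g f) ((mulOp.restrictScalars ℝ).map_smul δ⁻¹ P)
  have hfree : ∀ (s : ℝ) (f : L2), freeGroup α s (δ⁻¹ • f) = δ⁻¹ • freeGroup α s f := fun s f =>
    ((freeIso α s).toContinuousLinearEquiv.toContinuousLinearMap.restrictScalars ℝ).map_smul δ⁻¹ f
  have hyeq : ∀ t, y t = ψ₀ + ∫ s in (0 : ℝ)..t, δ⁻¹ • mulL2 P (y s) := by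
    intro t
    have h := intervalIntegral.integral_eq_sub_of_hasDerivAt (f := y)
      (f' := fun s => δ⁻¹ • mulL2 P (y s)) (a := 0) (b := t) (fun s _ => by
        have := (hz' (δ⁻¹ * s)).scomp s ((hasDerivAt_id s).const_mul δ⁻¹)
        rw [mul_one] at this
        exact this) (hPyc.intervalIntegrable _ _)
    rw [h, hy, hz]
    simp [mulL2_one]
  have hδmem : δ ∈ Set.Icc 0 δ := ⟨hδ.le, le_rfl⟩
  have h0mem : (0 : ℝ) ∈ Set.Icc 0 δ := ⟨le_rfl, hδ.le⟩
  have hb := isBddMeas_const (δ⁻¹ • v)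
  have key := le_exp_of_le_integral (f := fun t => ‖ψ t - y t‖) (η := 2 * η)
    (K := δ⁻¹ * ‖P‖) hδ.le (by positivity) (hψ.1.sub hyc.continuousOn).norm
    (fun _ _ => norm_nonneg _) (fun t ht => ?_) hδmem
  · have h3 : y δ = mulL2 (NormedSpace.exp P) ψ₀ := by
      simp [hy, hz, inv_mul_cancel₀ hδ.ne']
    rw [h3] at key
    refine key.trans_lt ?_
    rw [show δ⁻¹ * ‖P‖ * δ = ‖P‖ by field_simp, hη]
    have : 2 * (ε / (4 * Real.exp ‖P‖)) * Real.exp ‖P‖ = ε / 2 := by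
      field_simp; norm_num
    linarith
  · have hI₁ := hb.intervalIntegrable Q α (r := fun s => t - s) (by fun_prop) hψ.1 h0mem ht
    have hI₂ := hb.intervalIntegrable Q α (r := fun s => t - s) (by fun_prop)
      (hyc.continuousOn (s := Set.Icc 0 δ)) h0mem ht
    have hI₃ : IntervalIntegrable (fun s => δ⁻¹ • mulL2 P (y s)) volume 0 t :=
      hPyc.intervalIntegrable _ _
    -- Three contributions: the drift of the initial state, the drift of the source along `y`, and
    -- the feedback of the error. The first two are at most `η` each, and the third is the Grönwall
    -- term.
    have hsplit : ψ t - y t = (freeGroup α t ψ₀ - ψ₀) +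
        (∫ s in (0 : ℝ)..t, δ⁻¹ • (freeGroup α (t - s) (mulL2 P (y s)) - mulL2 P (y s))) +
        ∫ s in (0 : ℝ)..t, freeGroup α (t - s) (mulL2 (potential Q (δ⁻¹ • v)) (ψ s - y s)) := by
      simp only [mulL2_sub, freeGroup_sub]
      rw [intervalIntegral.integral_sub hI₁ hI₂, hψ.2 t ht, hyeq t]
      have : ∫ s in (0 : ℝ)..t, δ⁻¹ • (freeGroup α (t - s) (mulL2 P (y s)) - mulL2 P (y s)) =
          (∫ s in (0 : ℝ)..t, freeGroup α (t - s) (mulL2 (potential Q (δ⁻¹ • v)) (y s))) -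
            ∫ s in (0 : ℝ)..t, δ⁻¹ • mulL2 P (y s) := by
        rw [← intervalIntegral.integral_sub hI₂ hI₃]
        simp only [hsm, hfree, smul_sub]
      rw [this]
      abel
    rw [hsplit]
    have hA : ‖freeGroup α t ψ₀ - ψ₀‖ ≤ η :=
      (h₁ t (by rw [abs_of_nonneg ht.1]; linarith [ht.2]) 0 ⟨le_rfl, zero_le_one⟩).le
    have hB : ‖∫ s in (0 : ℝ)..t,
        δ⁻¹ • (freeGroup α (t - s) (mulL2 P (y s)) - mulL2 P (y s))‖ ≤ η := by
      refine (intervalIntegral.norm_integral_le_of_norm_le_const (C := δ⁻¹ * η)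
        fun s hs => ?_).trans ?_
      · rw [Set.uIoc_of_le ht.1] at hs
        rw [norm_smul, Real.norm_of_nonneg (by positivity)]
        refine mul_le_mul_of_nonneg_left (h₂ (t - s) ?_ (δ⁻¹ * s) ⟨?_, ?_⟩).le (by positivity)
        · rw [abs_of_nonneg (by linarith [hs.2])]; linarith [hs.1, ht.2]
        · have := hs.1; positivity
        · rw [inv_mul_le_iff₀ hδ]; linarith [hs.2, ht.2]
      · rw [sub_zero, abs_of_nonneg ht.1]
        calc δ⁻¹ * η * t ≤ δ⁻¹ * η * δ := by gcongr; exact ht.2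
          _ = η := by field_simp
    have hC := norm_integral_freeGroup_mulL2_le (α := α) (K := δ⁻¹ * ‖P‖) ht.1
      (g := fun _ => potential Q (δ⁻¹ • v)) (r := fun s => t - s) (fun _ => by
        rw [potential_smul, norm_smul, Real.norm_of_nonneg (by positivity)])
      ((hψ.1.sub hyc.continuousOn).mono (Set.Icc_subset_Icc_right ht.2))
    refine (norm_add₃_le).trans ?_
    simp only [Pi.sub_apply] at hC
    linarith

/-! ### Operators that are approximately reachable in small time -/

/-- The operator `S` can be approximated, strongly and in arbitrarily small time, by the flow of
the equation. -/
def Approx {q : ℕ} (α : ℝ) (Q : Fin q → C(Torus, ℝ)) (S : L2 → L2) : Prop :=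
  ∀ ψ₀ : L2, ∀ ε > 0, ∃ T, 0 < T ∧ T < ε ∧ ∃ ψ₁, Reach α Q T ψ₀ ψ₁ ∧ ‖ψ₁ - S ψ₀‖ < ε

lemma approx_exp_potential {q : ℕ} (α : ℝ) (Q : Fin q → C(Torus, ℝ)) (v : Fin q → ℝ) :
    Approx α Q (mulL2 (NormedSpace.exp (potential Q v))) := by
  intro ψ₀ ε hε
  obtain ⟨δ₀, hδ₀, h⟩ := exists_norm_solution_sub_lt α Q v ψ₀ hε
  have hm : 0 < min δ₀ ε := lt_min hδ₀ hε
  have h1 : min δ₀ ε / 2 < δ₀ := by linarith [min_le_left δ₀ ε]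
  obtain ⟨ψ, hψ⟩ := exists_isSolution_const α Q ((min δ₀ ε / 2)⁻¹ • v) (half_pos hm).le ψ₀
  exact ⟨min δ₀ ε / 2, half_pos hm, by linarith [min_le_right δ₀ ε], ψ (min δ₀ ε / 2),
    ⟨_, isPWC_const (half_pos hm) _, isBddMeas_const _, ψ, hψ, rfl⟩, h _ (half_pos hm) h1 ψ hψ⟩

/-- The second control is chosen for the state actually reached, and multiplication by a phase does
not amplify the first error. -/
lemma Approx.comp_mulL2 {q : ℕ} {α : ℝ} {Q : Fin q → C(Torus, ℝ)} {S : L2 → L2}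
    {θ : C(Torus, ℝ)} (h₁ : Approx α Q S) (h₂ : Approx α Q (mulL2 (phase θ))) :
    Approx α Q fun f => mulL2 (phase θ) (S f) := by
  intro ψ₀ ε hε
  obtain ⟨T₁, hT₁, hT₁ε, ψ₁, hr₁, hn₁⟩ := h₁ ψ₀ (ε / 2) (half_pos hε)
  obtain ⟨T₂, hT₂, hT₂ε, ψ₂, hr₂, hn₂⟩ := h₂ ψ₁ (ε / 2) (half_pos hε)
  refine ⟨T₁ + T₂, by positivity, by linarith, ψ₂, hr₁.trans hT₁.le hT₂ hr₂, ?_⟩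
  have h3 := norm_mulL2_phase_le θ (ψ₁ - S ψ₀)
  rw [mulL2_sub] at h3
  have h4 := norm_sub_le_norm_sub_add_norm_sub ψ₂ (mulL2 (phase θ) ψ₁) (mulL2 (phase θ) (S ψ₀))
  linarith

/-- Closure under strong limits: `R` may depend on `ψ₀` and `ε`. -/
lemma Approx.of_forall {q : ℕ} {α : ℝ} {Q : Fin q → C(Torus, ℝ)} {S : L2 → L2}
    (h : ∀ ψ₀ : L2, ∀ ε > 0, ∃ R, Approx α Q R ∧ ‖R ψ₀ - S ψ₀‖ < ε) : Approx α Q S := by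
  intro ψ₀ ε hε
  obtain ⟨R, hR, hRS⟩ := h ψ₀ (ε / 2) (half_pos hε)
  obtain ⟨T, hT, hTε, ψ₁, hr, hn⟩ := hR ψ₀ (ε / 2) (half_pos hε)
  refine ⟨T, hT, by linarith, ψ₁, hr, ?_⟩
  have := norm_sub_le_norm_sub_add_norm_sub ψ₁ (R ψ₀) (S ψ₀)
  linarith

/-! ### Differentiation on the torus -/

/-- `G` is the derivative of `F` on the torus. -/
def HasTorusDeriv (F G : C(Torus, ℂ)) : Prop :=
  ∀ x : ℝ, HasDerivAt (fun y : ℝ => F (y : Torus)) (G (x : Torus)) x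

namespace HasTorusDeriv

variable {F G F' G' : C(Torus, ℂ)}

lemma add (hF : HasTorusDeriv F F') (hG : HasTorusDeriv G G') :
    HasTorusDeriv (F + G) (F' + G') := fun x => (hF x).add (hG x)

lemma mul (hF : HasTorusDeriv F F') (hG : HasTorusDeriv G G') :
    HasTorusDeriv (F * G) (F' * G + F * G') := fun x => (hF x).mul (hG x)

lemma const_smul (c : ℂ) (hF : HasTorusDeriv F F') : HasTorusDeriv (c • F) (c • F') :=
  fun x => (hF x).const_mul c

lemma exp (hF : HasTorusDeriv F F') :
    HasTorusDeriv (NormedSpace.exp F) (F' * NormedSpace.exp F) := fun x => by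
  simp only [exp_apply, ContinuousMap.mul_apply]
  rw [mul_comm (F' (x : Torus))]
  exact (hF x).cexp

end HasTorusDeriv

lemma hasTorusDeriv_const (c : ℂ) : HasTorusDeriv (c • 1) 0 := fun x => by
  simpa using hasDerivAt_const x c

lemma hasTorusDeriv_fourier (k : ℤ) :
    HasTorusDeriv (fourier k) ((I * k) • fourier k) := fun x => by
  convert hasDerivAt_fourier (2 * Real.pi) k x using 1
  have : (Real.pi : ℂ) ≠ 0 := by exact_mod_cast Real.pi_ne_zero
  simp only [ContinuousMap.smul_apply, smul_eq_mul]
  push_cast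
  field_simp

/-- Integration by parts; the boundary terms cancel by periodicity. -/
lemma HasTorusDeriv.repr_toL2 {F G : C(Torus, ℂ)} (h : HasTorusDeriv F G) (k : ℤ) :
    fourierBasis.repr (toL2 G) k = I * k * fourierBasis.repr (toL2 F) k := by
  have hpi : (Real.pi : ℂ) ≠ 0 := by exact_mod_cast Real.pi_ne_zero
  rw [fourierBasis_repr, fourierBasis_repr, fourierCoeff_toLp, fourierCoeff_toLp,
    fourierCoeff_eq_intervalIntegral _ _ 0, fourierCoeff_eq_intervalIntegral _ _ 0]
  simp only [smul_eq_mul, zero_add]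
  have hF : Continuous fun x : ℝ => F (x : Torus) :=
    F.continuous.comp (AddCircle.continuous_mk' _)
  have hG : Continuous fun x : ℝ => G (x : Torus) :=
    G.continuous.comp (AddCircle.continuous_mk' _)
  have hE : Continuous fun x : ℝ => fourier (-k) (x : Torus) :=
    (fourier (-k)).continuous.comp (AddCircle.continuous_mk' _)
  have hper : ((2 * Real.pi : ℝ) : Torus) = ((0 : ℝ) : Torus) := by
    rw [AddCircle.coe_period]; rfl
  rw [intervalIntegral.integral_mul_deriv_eq_deriv_mul
    (fun x _ => hasDerivAt_fourier_neg (2 * Real.pi) k x) (fun x _ => h x)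
    ((continuous_const.mul hE).intervalIntegrable _ _) (hG.intervalIntegrable _ _), hper,
    sub_self, zero_sub]
  simp only [mul_assoc]
  rw [intervalIntegral.integral_const_mul]
  simp only [← mul_assoc, real_smul]
  push_cast
  field_simp

/-- Links the differential expression for `L` on regular functions to its symbol, so that no domain
of an unbounded operator is needed. -/
lemma repr_toL2_generator (α : ℝ) {y y₁ y₂ y₃ : C(Torus, ℂ)} (h₁ : HasTorusDeriv y y₁)
    (h₂ : HasTorusDeriv y₁ y₂) (h₃ : HasTorusDeriv y₂ y₃) (k : ℤ) :
    fourierBasis.repr (toL2 (-y₃ + (I * α) • y₂)) k =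
      airySymbol α k * fourierBasis.repr (toL2 y) k := by
  have : toL2 (-y₃ + (I * α) • y₂) = -toL2 y₃ + (I * α) • toL2 y₂ := by
    rw [map_add, map_neg, map_smul]
  rw [this, map_add, map_neg, map_smul, lp.coeFn_add, Pi.add_apply, lp.coeFn_neg, Pi.neg_apply,
    lp.coeFn_smul, Pi.smul_apply, smul_eq_mul, h₃.repr_toL2, h₂.repr_toL2, h₁.repr_toL2,
    airySymbol]
  ring

/-- A time-dependent function which solves the (rescaled) free equation up to an error of size
`η` stays `η`-close to the free evolution. -/
lemma norm_sub_freeGroup_le (α c η : ℝ) {Y Y' Z : ℝ → C(Torus, ℂ)}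
    (hY : ∀ τ, HasDerivAt Y (Y' τ) τ)
    (hZ : ∀ τ k, fourierBasis.repr (toL2 (Z τ)) k =
      airySymbol α k * fourierBasis.repr (toL2 (Y τ)) k)
    (hR : Continuous fun τ => Y' τ - c • Z τ)
    (hη : ∀ τ ∈ Set.Icc (0 : ℝ) 1, ‖Y' τ - c • Z τ‖ ≤ η) :
    ‖toL2 (Y 1) - freeGroup α c (toL2 (Y 0))‖ ≤ η := by
  set R : ℝ → L2 := fun τ => freeGroup α (-(c * τ)) (toL2 (Y' τ - c • Z τ)) with hRdef
  have hRc : Continuous R := (continuous_freeGroup α).comp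
    (f := fun τ => (-(c * τ), toL2 (Y' τ - c • Z τ)))
    ((by fun_prop : Continuous fun τ : ℝ => -(c * τ)).prodMk (toL2.continuous.comp hR))
  have hD : ‖∫ τ in (0 : ℝ)..1, R τ‖ ≤ η := by
    refine (intervalIntegral.norm_integral_le_of_norm_le_const (C := η) fun τ hτ => ?_).trans
      (by simp)
    rw [Set.uIoc_of_le zero_le_one] at hτ
    rw [hRdef]
    simp only [norm_freeGroup]
    exact (norm_toL2_le _).trans (hη τ ⟨hτ.1.le, hτ.2⟩)
  have hcoord : ∀ (f : L2) (k : ℤ), fourierBasis.repr f k = innerSL ℂ (fourierBasis k) f :=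
    fun f k => by rw [HilbertBasis.repr_apply_apply]; rfl
  -- With `Z = LY`, the curve `R` is the derivative of `e^{-cτL} Y(τ)`. This is checked on each
  -- Fourier coefficient, where the group is a scalar exponential.
  have key : ∫ τ in (0 : ℝ)..1, R τ = freeGroup α (-c) (toL2 (Y 1)) - toL2 (Y 0) := by
    refine L2.ext_repr fun k => ?_
    rw [hcoord, ← ContinuousLinearMap.intervalIntegral_comp_comm _
      (hRc.intervalIntegrable _ _)]
    have hder : ∀ τ ∈ Set.uIcc (0 : ℝ) 1, HasDerivAt
        (fun τ : ℝ => exp ((-(c * τ) : ℝ) * airySymbol α k) *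
          innerSL ℂ (fourierBasis k) (toL2 (Y τ)))
        (innerSL ℂ (fourierBasis k) (R τ)) τ := by
      intro τ _
      have h1 : HasDerivAt (fun τ : ℝ => exp ((-(c * τ) : ℝ) * airySymbol α k))
          (exp ((-(c * τ) : ℝ) * airySymbol α k) * (((-(c * 1) : ℝ) : ℂ) * airySymbol α k)) τ :=
        (((((hasDerivAt_id τ).const_mul c).neg).ofReal_comp).mul_const _).cexp
      have h2 : HasDerivAt (fun τ : ℝ => innerSL ℂ (fourierBasis k) (toL2 (Y τ)))
          (innerSL ℂ (fourierBasis k) (toL2 (Y' τ))) τ :=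
        ((((innerSL ℂ (fourierBasis k : L2)).comp toL2).restrictScalars ℝ).hasFDerivAt
          (x := Y τ)).comp_hasDerivAt τ (hY τ)
      have h3 := h1.mul h2
      refine h3.congr_deriv ?_
      have h4 : toL2 (Y' τ - c • Z τ) = toL2 (Y' τ) - (c : ℂ) • toL2 (Z τ) := by
        rw [map_sub, ← map_smul]; rfl
      rw [← hcoord, ← hcoord, ← hcoord, hRdef]
      simp only [repr_freeGroup]
      rw [h4, map_sub, map_smul, lp.coeFn_sub, Pi.sub_apply, lp.coeFn_smul, Pi.smul_apply,
        smul_eq_mul, hZ]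
      push_cast
      ring
    rw [intervalIntegral.integral_eq_sub_of_hasDerivAt hder
      (((innerSL ℂ (fourierBasis k)).continuous.comp hRc).intervalIntegrable _ _)]
    rw [← hcoord, ← hcoord, map_sub, lp.coeFn_sub, Pi.sub_apply, repr_freeGroup]
    simp
  rw [key] at hD
  rw [← norm_freeGroup α (-c), freeGroup_sub, ← freeGroup_add, neg_add_cancel, freeGroup_zero]
  exact hD

lemma IsSmooth.exists_deriv {f : C(Torus, ℝ)} (hf : IsSmooth f) :
    ∃ f' : C(Torus, ℝ), IsSmooth f' ∧
      ∀ x : ℝ, HasDerivAt (fun y : ℝ => f (y : Torus)) (f' (x : Torus)) x := by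
  have hper : Function.Periodic (deriv fun y : ℝ => f (y : Torus)) (2 * Real.pi) := by
    intro x
    rw [← deriv_comp_add_const]
    simp
  have hsm : ContDiff ℝ ∞ (deriv fun y : ℝ => f (y : Torus)) :=
    (contDiff_infty_iff_deriv.1 hf).2
  have hdiff : Differentiable ℝ fun y : ℝ => f (y : Torus) := (contDiff_infty_iff_deriv.1 hf).1
  refine ⟨⟨hper.lift, ?_⟩, ?_, fun x => ?_⟩
  · exact continuous_coinduced_dom.mpr hsm.continuous
  · exact hsm
  · exact (hdiff x).hasDerivAt

lemma HasDerivAt.toC {f f' : C(Torus, ℝ)}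
    (h : ∀ x : ℝ, HasDerivAt (fun y : ℝ => f (y : Torus)) (f' (x : Torus)) x) :
    HasTorusDeriv (toC f) (KdVSch.toC f') := fun x => (h x).ofReal_comp

/-! ### Fast oscillations conjugating the free evolution -/

lemma phase_smul_mul_exp (l τ : ℝ) (φ γ : C(Torus, ℝ)) :
    NormedSpace.exp (l • (I • toC φ)) * NormedSpace.exp (τ • (I • toC γ)) =
      phase (l • φ + τ • γ) := by
  ext x
  simp only [ContinuousMap.mul_apply, exp_apply, phase, ContinuousMap.coe_mk, ← exp_add]
  congr 1
  simp
  ring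

/-- Conjugated by `e^{iφ/μ}`, the free evolution during the time `μ³` is close to
multiplication by `e^{i φ'³}`; here tested on a single Fourier mode. -/
lemma exists_conj_fourier_lt (α : ℝ) {φ φ' : C(Torus, ℝ)} (hφ' : IsSmooth φ')
    (h : ∀ x : ℝ, HasDerivAt (fun y : ℝ => φ (y : Torus)) (φ' (x : Torus)) x) (k : ℤ)
    {η : ℝ} (hη : 0 < η) :
    ∃ δ > 0, ∀ μ : ℝ, 0 < μ → μ < δ →
      ‖mulL2 (phase (μ⁻¹ • φ)) (mulL2 (phase (φ' ^ 3)) (toL2 (fourier k))) -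
        freeGroup α (μ ^ 3) (mulL2 (phase (μ⁻¹ • φ)) (toL2 (fourier k)))‖ ≤ η := by
  obtain ⟨φ₂, hφ₂, h₂⟩ := hφ'.exists_deriv
  obtain ⟨φ₃, -, h₃⟩ := hφ₂.exists_deriv
  have hγ : IsSmooth (φ' ^ 3) := ContDiff.pow hφ' 3
  obtain ⟨γ₁, hγ₁, k₁⟩ := hγ.exists_deriv
  obtain ⟨γ₂, hγ₂, k₂⟩ := hγ₁.exists_deriv
  obtain ⟨γ₃, -, k₃⟩ := hγ₂.exists_deriv
  set A := I • toC φ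
  set a := I • toC φ' with ha
  set a₁ := I • toC φ₂
  set a₂ := I • toC φ₃
  set g := I • toC (φ' ^ 3) with hg
  set b := I • toC γ₁
  set b₁ := I • toC γ₂
  set b₂ := I • toC γ₃
  have dA : HasTorusDeriv A a := (HasDerivAt.toC h).const_smul I
  have da : HasTorusDeriv a a₁ := (HasDerivAt.toC h₂).const_smul I
  have da₁ : HasTorusDeriv a₁ a₂ := (HasDerivAt.toC h₃).const_smul I
  have dg : HasTorusDeriv g b := (HasDerivAt.toC k₁).const_smul I
  have db : HasTorusDeriv b b₁ := (HasDerivAt.toC k₂).const_smul I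
  have db₁ : HasTorusDeriv b₁ b₂ := (HasDerivAt.toC k₃).const_smul I
  -- This is the cancellation at leading order: it makes the residual vanish at `μ = 0`.
  have hga : g = -a ^ 3 := by
    ext x
    simp only [hg, ha, ContinuousMap.smul_apply, ContinuousMap.neg_apply, ContinuousMap.pow_apply,
      toC_apply, smul_eq_mul, mul_pow, I_pow_three]
    push_cast
    ring
  set c : C(Torus, ℂ) := (I * k) • 1
  -- With `p = (μ, τ)`, these are `μ` times the logarithmic derivative `s` of `Y` below and its
  -- derivatives `s₁`, `s₂`. Being polynomial in `μ`, they stay continuous at `μ = 0`, and so does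
  -- the residual factor `E`.
  set S : ℝ × ℝ → C(Torus, ℂ) := fun p => a + p.1 • (p.2 • b + c) with hS
  set S₁ : ℝ × ℝ → C(Torus, ℂ) := fun p => a₁ + p.1 • (p.2 • b₁) with hS₁
  set S₂ : ℝ × ℝ → C(Torus, ℂ) := fun p => a₂ + p.1 • (p.2 • b₂) with hS₂
  set E : ℝ × ℝ → C(Torus, ℂ) := fun p => g + (S p ^ 3 + p.1 • ((3 : ℝ) • (S p * S₁ p)) +
    p.1 ^ 2 • S₂ p) - (I * α) • (p.1 • (p.1 • S₁ p + S p ^ 2)) with hE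
  have hSc : Continuous S := by fun_prop
  have hS₁c : Continuous S₁ := by fun_prop
  have hS₂c : Continuous S₂ := by fun_prop
  have hEc : Continuous E := by fun_prop
  have hE0 : ∀ τ, E (0, τ) = 0 := fun τ => by simp [hE, hS, hga]
  obtain ⟨δ, hδ, hsmall⟩ := exists_uniform_small hEc hE0 hη
  refine ⟨δ, hδ, fun μ hμ hμδ => ?_⟩
  set l : ℝ := μ⁻¹ with hl
  -- An explicit path from `e^{iφ/μ} e_k` at `τ = 0` to `e^{iφ/μ} e^{iφ'³} e_k` at `τ = 1`. It
  -- satisfies `Y' = gY`, and `gY - μ³LY = E(μ, τ) Y`.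
  set Y : ℝ → C(Torus, ℂ) := fun τ =>
    (NormedSpace.exp (l • A) * fourier k) * NormedSpace.exp (τ • g) with hY
  have hYphase : ∀ τ, Y τ = phase (l • φ + τ • φ' ^ 3) * fourier k := fun τ => by
    rw [hY, ← phase_smul_mul_exp]
    ring
  have hYd : ∀ τ, HasDerivAt Y (g * Y τ) τ := fun τ => by
    refine ((hasDerivAt_exp_smul_const' (𝕂 := ℝ) g τ).const_mul
      (NormedSpace.exp (l • A) * fourier k)).congr_deriv ?_
    rw [hY]; ring
  have hYn : ∀ τ, ‖Y τ‖ ≤ 1 := fun τ => by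
    rw [hYphase]
    refine (norm_mul_le _ _).trans ?_
    rw [fourier_norm, mul_one]
    exact norm_phase_le _
  set s : ℝ → C(Torus, ℂ) := fun τ => l • a + τ • b + c
  set s₁ : ℝ → C(Torus, ℂ) := fun τ => l • a₁ + τ • b₁
  set s₂ : ℝ → C(Torus, ℂ) := fun τ => l • a₂ + τ • b₂
  have hrs : ∀ (r : ℝ) (F F' : C(Torus, ℂ)), HasTorusDeriv F F' →
      HasTorusDeriv (r • F) (r • F') := fun r F F' hF => hF.const_smul (r : ℂ)
  have ds : ∀ τ, HasTorusDeriv (s τ) (s₁ τ) := fun τ => by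
    have := ((hrs l _ _ da).add (hrs τ _ _ db)).add (hasTorusDeriv_const (I * k))
    rwa [add_zero] at this
  have ds₁ : ∀ τ, HasTorusDeriv (s₁ τ) (s₂ τ) := fun τ => (hrs l _ _ da₁).add (hrs τ _ _ db₁)
  have dY : ∀ τ, HasTorusDeriv (Y τ) (s τ * Y τ) := fun τ => by
    have := ((hrs l _ _ dA).exp.mul (hasTorusDeriv_fourier k)).mul (hrs τ _ _ dg).exp
    convert this using 1
    ext x
    simp [Y, s, c]
    ring
  have dY₂ := fun τ => (ds τ).mul (dY τ)
  have dY₃ := fun τ => ((ds₁ τ).mul (dY τ)).add ((ds τ).mul (dY₂ τ))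
  have hR : ∀ τ, g * Y τ - (μ ^ 3) • (-(s₂ τ * Y τ + s₁ τ * (s τ * Y τ) +
      (s₁ τ * (s τ * Y τ) + s τ * (s₁ τ * Y τ + s τ * (s τ * Y τ)))) +
      (I * α) • (s₁ τ * Y τ + s τ * (s τ * Y τ))) = E (μ, τ) * Y τ := fun τ => by
    have hμl : (μ : ℂ) * (l : ℂ) = 1 := by
      rw [← ofReal_mul, hl, mul_inv_cancel₀ hμ.ne', ofReal_one]
    have e0 : μ • s τ = S (μ, τ) := by
      ext x
      simp [s, hS]
      linear_combination (a x) * hμl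
    have e1 : μ • s₁ τ = S₁ (μ, τ) := by
      ext x
      simp [s₁, hS₁]
      linear_combination (a₁ x) * hμl
    have e2 : μ • s₂ τ = S₂ (μ, τ) := by
      ext x
      simp [s₂, hS₂]
      linear_combination (a₂ x) * hμl
    simp only [hE, ← e0, ← e1, ← e2]
    ext x
    simp
    ring
  have hfin := norm_sub_freeGroup_le α (μ ^ 3) η hYd
    (fun τ j => repr_toL2_generator α (dY τ) (dY₂ τ) (dY₃ τ) j) (by
      simp only [hR]
      exact (hEc.comp (by fun_prop : Continuous fun τ : ℝ => (μ, τ))).mul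
        (continuous_iff_continuousAt.2 fun τ => (hYd τ).continuousAt)) (fun τ hτ => by
      rw [hR]
      refine (norm_mul_le _ _).trans ?_
      have h1 := hsmall μ (by rwa [abs_of_pos hμ]) τ hτ
      nlinarith [hYn τ, norm_nonneg (E (μ, τ))])
  rw [hYphase, hYphase, one_smul, zero_smul, add_zero, phase_add] at hfin
  rwa [mulL2_toL2, mulL2_toL2, mulL2_toL2, ← mul_assoc]

/-- The error operators `D μ` are bounded by 2 uniformly in `μ`, so the vectors on which they tend
to 0 form a closed subspace; it contains every Fourier mode. -/
lemma exists_conj_lt (α : ℝ) {φ φ' : C(Torus, ℝ)} (hφ' : IsSmooth φ')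
    (h : ∀ x : ℝ, HasDerivAt (fun y : ℝ => φ (y : Torus)) (φ' (x : Torus)) x) (f : L2)
    {η : ℝ} (hη : 0 < η) :
    ∃ δ > 0, ∀ μ : ℝ, 0 < μ → μ < δ →
      ‖mulL2 (phase (μ⁻¹ • φ)) (mulL2 (phase (φ' ^ 3)) f) -
        freeGroup α (μ ^ 3) (mulL2 (phase (μ⁻¹ • φ)) f)‖ < η := by
  let D : ℝ → L2 →L[ℂ] L2 := fun μ =>
    (mulOp (phase (μ⁻¹ • φ))).comp (mulOp (phase (φ' ^ 3))) -
      (freeIso α (μ ^ 3)).toContinuousLinearEquiv.toContinuousLinearMap.comp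
        (mulOp (phase (μ⁻¹ • φ)))
  have hDn : ∀ μ f, ‖D μ f‖ ≤ 2 * ‖f‖ := fun μ f => by
    change ‖mulL2 (phase (μ⁻¹ • φ)) (mulL2 (phase (φ' ^ 3)) f) -
        freeGroup α (μ ^ 3) (mulL2 (phase (μ⁻¹ • φ)) f)‖ ≤ _
    refine (norm_sub_le _ _).trans ?_
    rw [norm_freeGroup]
    have h1 := norm_mulL2_phase_le (μ⁻¹ • φ) (mulL2 (phase (φ' ^ 3)) f)
    have h2 := norm_mulL2_phase_le (φ' ^ 3) f
    have h3 := norm_mulL2_phase_le (μ⁻¹ • φ) f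
    linarith
  let S : Submodule ℂ L2 :=
    { carrier := {f | Filter.Tendsto (fun μ => D μ f) (nhdsWithin 0 (Set.Ioi 0)) (nhds 0)}
      add_mem' := fun {f g} hf hg => by
        simpa using Filter.Tendsto.add hf hg
      zero_mem' := by simp
      smul_mem' := fun c f hf => by
        simpa using Filter.Tendsto.const_smul hf c }
  have hSc : IsClosed (S : Set L2) := by
    rw [← isSeqClosed_iff_isClosed]
    intro u f hu huf
    change Filter.Tendsto (fun μ => D μ f) (nhdsWithin 0 (Set.Ioi 0)) (nhds 0)
    rw [Metric.tendsto_nhds]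
    intro ε hε
    obtain ⟨n, hn⟩ := (Metric.tendsto_nhds.1 huf (ε / 4) (by positivity)).exists
    filter_upwards [Metric.tendsto_nhds.1 (hu n) (ε / 4) (by positivity)] with μ hμ
    rw [dist_zero_right] at hμ ⊢
    rw [dist_comm, dist_eq_norm] at hn
    have h1 := hDn μ (f - u n)
    rw [map_sub] at h1
    have h2 := norm_le_norm_add_norm_sub (D μ (u n)) (D μ f)
    rw [norm_sub_rev] at h2
    linarith [norm_sub_rev (D μ (u n)) (D μ f)]
  have hmem : f ∈ S := by
    refine L2.mem_of_fourier S hSc (fun k => ?_) f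
    change Filter.Tendsto (fun μ => D μ (fourierLp 2 k)) (nhdsWithin 0 (Set.Ioi 0)) (nhds 0)
    rw [Metric.tendsto_nhds]
    intro ε hε
    obtain ⟨δ, hδ, hlt⟩ := exists_conj_fourier_lt α hφ' h k (half_pos hε)
    filter_upwards [Ioo_mem_nhdsGT hδ] with μ hμ
    rw [dist_zero_right]
    exact (hlt μ hμ.1 hμ.2).trans_lt (half_lt_self hε)
  obtain ⟨δ, hδ, hball⟩ := mem_nhdsGT_iff_exists_Ioo_subset.1 (Metric.tendsto_nhds.1 hmem η hη)
  refine ⟨δ, hδ, fun μ h0 hμ => ?_⟩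
  have := hball ⟨h0, hμ⟩
  rwa [Set.mem_ofPred_eq, dist_zero_right] at this

/-! ### The space of controllable phases -/

/-- Apply approximately `e^{iφ/μ}`, let the system evolve freely for the time `μ³`, then undo the
phase. The large multiples `±1/μ` are why `hφ` is required for every `c`. -/
lemma approx_phase_cube {q : ℕ} {α : ℝ} {Q : Fin q → C(Torus, ℝ)} {φ φ' : C(Torus, ℝ)}
    (hφ : ∀ c : ℝ, Approx α Q (mulL2 (phase (c • φ)))) (hφ' : IsSmooth φ')
    (h : ∀ x : ℝ, HasDerivAt (fun y : ℝ => φ (y : Torus)) (φ' (x : Torus)) x) :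
    Approx α Q (mulL2 (phase (φ' ^ 3))) := by
  intro ψ₀ ε hε
  obtain ⟨δ, hδ, hlt⟩ := exists_conj_lt α hφ' h ψ₀ (η := ε / 4) (by positivity)
  -- The bound by 1 gives `μ³ ≤ μ ≤ ε/4`, so the three legs together take less than `ε`.
  set μ := min (δ / 2) (min (ε / 4) 1) with hμ
  have hμ0 : 0 < μ := by positivity
  have hμδ : μ < δ := (min_le_left _ _).trans_lt (half_lt_self hδ)
  have hμε : μ ≤ ε / 4 := (min_le_right _ _).trans (min_le_left _ _)
  have hμ1 : μ ≤ 1 := (min_le_right _ _).trans (min_le_right _ _)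
  have hμ3 : μ ^ 3 ≤ ε / 4 := (pow_le_of_le_one hμ0.le hμ1 (by norm_num)).trans hμε
  obtain ⟨T₁, hT₁, hT₁ε, ψ₁, hr₁, hn₁⟩ := hφ μ⁻¹ ψ₀ (ε / 4) (by positivity)
  obtain ⟨T₃, hT₃, hT₃ε, ψ₃, hr₃, hn₃⟩ :=
    hφ (-μ⁻¹) (freeGroup α (μ ^ 3) ψ₁) (ε / 4) (by positivity)
  have hμ3' : 0 < μ ^ 3 := by positivity
  refine ⟨T₁ + μ ^ 3 + T₃, by positivity, by linarith, ψ₃,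
    (hr₁.trans hT₁.le hμ3' (Reach.free α Q hμ3' ψ₁)).trans (by positivity) hT₃ hr₃, ?_⟩
  set V := mulL2 (phase (-μ⁻¹ • φ)) with hV
  have hinv : ∀ f, V (mulL2 (phase (μ⁻¹ • φ)) f) = f := fun f => by
    rw [hV, ← mulL2_mul, ← phase_add, neg_smul, neg_add_cancel, phase_zero, mulL2_one]
  have hA : ‖V (freeGroup α (μ ^ 3) ψ₁) -
      V (freeGroup α (μ ^ 3) (mulL2 (phase (μ⁻¹ • φ)) ψ₀))‖ < ε / 4 := by
    rw [hV, ← mulL2_sub, ← freeGroup_sub]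
    refine (norm_mulL2_phase_le _ _).trans_lt ?_
    rwa [norm_freeGroup]
  have hB : ‖V (freeGroup α (μ ^ 3) (mulL2 (phase (μ⁻¹ • φ)) ψ₀)) -
      mulL2 (phase (φ' ^ 3)) ψ₀‖ < ε / 4 := by
    rw [← hinv (mulL2 (phase (φ' ^ 3)) ψ₀), hV, ← mulL2_sub]
    refine (norm_mulL2_phase_le _ _).trans_lt ?_
    rw [norm_sub_rev]
    exact hlt μ hμ0 hμδ
  have h1 := norm_sub_le_norm_sub_add_norm_sub ψ₃ (V (freeGroup α (μ ^ 3) ψ₁))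
    (mulL2 (phase (φ' ^ 3)) ψ₀)
  have h2 := norm_sub_le_norm_sub_add_norm_sub (V (freeGroup α (μ ^ 3) ψ₁))
    (V (freeGroup α (μ ^ 3) (mulL2 (phase (μ⁻¹ • φ)) ψ₀))) (mulL2 (phase (φ' ^ 3)) ψ₀)
  linarith

variable {q : ℕ} (α : ℝ) (Q : Fin q → C(Torus, ℝ))

/-- The functions `φ` such that multiplication by `e^{icφ}` is approximately reachable in small
time for all real `c`. -/
def phaseSpace : Submodule ℝ C(Torus, ℝ) where
  carrier := {φ | ∀ c : ℝ, Approx α Q (mulL2 (phase (c • φ)))}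
  add_mem' {φ ψ} hφ hψ c := by
    have := (hψ c).comp_mulL2 (hφ c)
    rw [smul_add, phase_add, funext (mulL2_mul (phase (c • φ)) (phase (c • ψ)))]
    exact this
  zero_mem' c := by
    have := approx_exp_potential α Q 0
    rw [potential_eq_sum] at this
    simpa [phase_zero] using this
  smul_mem' a φ hφ c := by
    rw [smul_smul]
    exact hφ _

variable {α Q}

lemma continuous_phase : Continuous phase :=
  ContinuousMap.continuous_postcomp
    (⟨fun r : ℝ => exp (I * (r : ℂ)), by fun_prop⟩ : C(ℝ, ℂ))

/-- Uniform convergence of the angles gives norm convergence of the phases, hence strong convergence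
of the multiplication operators. -/
lemma isClosed_phaseSpace : IsClosed (phaseSpace α Q : Set C(Torus, ℝ)) := by
  rw [← isSeqClosed_iff_isClosed]
  intro u φ hu hφ c
  refine Approx.of_forall fun ψ₀ ε hε => ?_
  have hc : Continuous fun θ => mulL2 (phase (c • θ)) ψ₀ :=
    (mulOp.flip ψ₀).continuous.comp (continuous_phase.comp (continuous_const_smul c))
  obtain ⟨n, hn⟩ := (Metric.tendsto_nhds.1 ((hc.tendsto φ).comp hφ) ε hε).exists
  exact ⟨_, hu n c, by rwa [dist_eq_norm] at hn⟩

lemma mem_phaseSpace_of_span {f : C(Torus, ℝ)}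
    (hf : (fun x : ℝ => f (x : Torus)) ∈
      Submodule.span ℝ (Set.range fun (j : Fin q) (x : ℝ) => Q j (x : Torus))) :
    f ∈ phaseSpace α Q := by
  obtain ⟨v, hv⟩ := (Submodule.mem_span_range_iff_exists_fun ℝ).1 hf
  intro c
  have : phase (c • f) = NormedSpace.exp (potential Q (c • v)) := by
    ext x
    induction x using QuotientAddGroup.induction_on with | _ x
    have hx := congrFun hv x
    simp only [Finset.sum_apply, Pi.smul_apply, smul_eq_mul] at hx
    rw [exp_apply]
    simp only [phase, potential, ContinuousMap.coe_mk, ContinuousMap.smul_apply, Pi.smul_apply,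
      smul_eq_mul, mul_assoc, ← Finset.mul_sum]
    rw [← hx]
  rw [this]
  exact approx_exp_potential α Q _

variable (α Q) in
/-- Smooth derivatives of elements of `phaseSpace`. -/
def derivSpace : Submodule ℝ C(Torus, ℝ) where
  carrier := {f | IsSmooth f ∧ ∃ φ ∈ phaseSpace α Q,
    ∀ x : ℝ, HasDerivAt (fun y : ℝ => φ (y : Torus)) (f (x : Torus)) x}
  add_mem' := by
    rintro f g ⟨hf, φ, hφ, hφf⟩ ⟨hg, ψ, hψ, hψg⟩
    exact ⟨ContDiff.add hf hg, φ + ψ, add_mem hφ hψ, fun x => (hφf x).add (hψg x)⟩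
  zero_mem' := ⟨contDiff_const, 0, zero_mem _, fun x => hasDerivAt_const x 0⟩
  smul_mem' := by
    rintro c f ⟨hf, φ, hφ, hφf⟩
    exact ⟨ContDiff.const_smul c hf, c • φ, Submodule.smul_mem _ c hφ,
      fun x => (hφf x).const_smul c⟩

/-- A factor `c ≥ 0` is absorbed into `f` through its cube root; negative factors follow because the
cube is odd. -/
lemma cube_mem_phaseSpace {f : C(Torus, ℝ)} (hf : f ∈ derivSpace α Q) :
    f ^ 3 ∈ phaseSpace α Q := by
  have key : ∀ c : ℝ, 0 ≤ c → ∀ g ∈ derivSpace α Q, Approx α Q (mulL2 (phase (c • g ^ 3))) := by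
    intro c hc g hg
    obtain ⟨hs, φ, hφ, hd⟩ := Submodule.smul_mem _ (c ^ (((3 : ℕ) : ℝ)⁻¹)) hg
    have := approx_phase_cube hφ hs hd
    rwa [smul_pow, Real.rpow_inv_natCast_pow hc (by norm_num)] at this
  intro c
  rcases le_total 0 c with hc | hc
  · exact key c hc f hf
  · have := key (-c) (by linarith) (-f) (neg_mem hf)
    rwa [Odd.neg_pow (by decide), smul_neg, neg_smul, neg_neg] at this

/-- Polarization: a trilinear product is a linear combination of cubes. -/
lemma mul_mul_mem_phaseSpace {f g h : C(Torus, ℝ)} (hf : f ∈ derivSpace α Q)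
    (hg : g ∈ derivSpace α Q) (hh : h ∈ derivSpace α Q) : f * g * h ∈ phaseSpace α Q := by
  have h1 : f * g * h = (24⁻¹ : ℝ) •
      ((f + g + h) ^ 3 - (f + g - h) ^ 3 - (f - g + h) ^ 3 - (g + h - f) ^ 3) := by
    ext x
    simp
    ring
  rw [h1]
  refine Submodule.smul_mem _ _ (sub_mem (sub_mem (sub_mem ?_ ?_) ?_) ?_)
  · exact cube_mem_phaseSpace (add_mem (add_mem hf hg) hh)
  · exact cube_mem_phaseSpace (sub_mem (add_mem hf hg) hh)
  · exact cube_mem_phaseSpace (add_mem (sub_mem hf hg) hh)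
  · exact cube_mem_phaseSpace (sub_mem (add_mem hg hh) hf)

/-! ### Trigonometric modes -/

/-- Real part of a complex-valued function. -/
def rePart (F : C(Torus, ℂ)) : C(Torus, ℝ) := (⟨re, continuous_re⟩ : C(ℂ, ℝ)).comp F

/-- Imaginary part of a complex-valued function. -/
def imPart (F : C(Torus, ℂ)) : C(Torus, ℝ) := (⟨im, continuous_im⟩ : C(ℂ, ℝ)).comp F

@[simp] lemma rePart_apply (F : C(Torus, ℂ)) (x : Torus) : rePart F x = (F x).re := rfl

@[simp] lemma imPart_apply (F : C(Torus, ℂ)) (x : Torus) : imPart F x = (F x).im := rfl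

lemma fourier_coe (k : ℤ) (x : ℝ) :
    fourier k (x : Torus) = exp (((k * x : ℝ) : ℂ) * I) := by
  rw [fourier_coe_apply]
  congr 1
  have : (Real.pi : ℂ) ≠ 0 := by exact_mod_cast Real.pi_ne_zero
  push_cast
  field_simp

lemma rePart_fourier_coe (k : ℤ) (x : ℝ) :
    rePart (fourier k) (x : Torus) = Real.cos (k * x) := by
  rw [rePart_apply, fourier_coe, exp_ofReal_mul_I_re]

lemma imPart_fourier_coe (k : ℤ) (x : ℝ) :
    imPart (fourier k) (x : Torus) = Real.sin (k * x) := by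
  rw [imPart_apply, fourier_coe, exp_ofReal_mul_I_im]

lemma rePart_fourier_mem_derivSpace {k : ℤ} (hk : k ≠ 0)
    (h : imPart (fourier k) ∈ phaseSpace α Q) : rePart (fourier k) ∈ derivSpace α Q := by
  have hk' : (k : ℝ) ≠ 0 := by exact_mod_cast hk
  refine ⟨?_, (k : ℝ)⁻¹ • imPart (fourier k), Submodule.smul_mem _ _ h, fun x => ?_⟩
  · simp only [IsSmooth, rePart_fourier_coe]
    exact Real.contDiff_cos.comp (contDiff_const.mul contDiff_id)
  · simp only [ContinuousMap.smul_apply, rePart_fourier_coe, imPart_fourier_coe, smul_eq_mul]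
    refine ((((hasDerivAt_id x).const_mul (k : ℝ)).sin).const_mul (k : ℝ)⁻¹).congr_deriv ?_
    simp only [id]
    field_simp

lemma imPart_fourier_mem_derivSpace {k : ℤ} (hk : k ≠ 0)
    (h : rePart (fourier k) ∈ phaseSpace α Q) : imPart (fourier k) ∈ derivSpace α Q := by
  have hk' : (k : ℝ) ≠ 0 := by exact_mod_cast hk
  refine ⟨?_, (-(k : ℝ)⁻¹) • rePart (fourier k), Submodule.smul_mem _ _ h, fun x => ?_⟩
  · simp only [IsSmooth, imPart_fourier_coe]
    exact Real.contDiff_sin.comp (contDiff_const.mul contDiff_id)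
  · simp only [ContinuousMap.smul_apply, rePart_fourier_coe, imPart_fourier_coe, smul_eq_mul]
    refine ((((hasDerivAt_id x).const_mul (k : ℝ)).cos).const_mul (-(k : ℝ)⁻¹)).congr_deriv ?_
    simp only [id]
    field_simp

/-- At nonzero frequency sine and cosine are multiples of each other's derivatives, so both parts of
each mode lie in `derivSpace`. Expanding `e_a e_b e_c` into real and imaginary parts leaves only
triple products. -/
lemma fourier_add_mem_phaseSpace {a b c : ℤ} (ha : a ≠ 0) (hb : b ≠ 0) (hc : c ≠ 0)
    (ha' : rePart (fourier a) ∈ phaseSpace α Q ∧ imPart (fourier a) ∈ phaseSpace α Q)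
    (hb' : rePart (fourier b) ∈ phaseSpace α Q ∧ imPart (fourier b) ∈ phaseSpace α Q)
    (hc' : rePart (fourier c) ∈ phaseSpace α Q ∧ imPart (fourier c) ∈ phaseSpace α Q) :
    rePart (fourier (a + b + c)) ∈ phaseSpace α Q ∧
      imPart (fourier (a + b + c)) ∈ phaseSpace α Q := by
  have ra := rePart_fourier_mem_derivSpace ha ha'.2
  have ia := imPart_fourier_mem_derivSpace ha ha'.1
  have rb := rePart_fourier_mem_derivSpace hb hb'.2
  have ib := imPart_fourier_mem_derivSpace hb hb'.1
  have rc := rePart_fourier_mem_derivSpace hc hc'.2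
  have ic := imPart_fourier_mem_derivSpace hc hc'.1
  constructor
  · have : rePart (fourier (a + b + c)) =
        rePart (fourier a) * rePart (fourier b) * rePart (fourier c) -
          imPart (fourier a) * imPart (fourier b) * rePart (fourier c) -
          imPart (fourier a) * rePart (fourier b) * imPart (fourier c) -
          rePart (fourier a) * imPart (fourier b) * imPart (fourier c) := by
      ext x
      simp only [rePart_apply, imPart_apply, ContinuousMap.sub_apply, ContinuousMap.mul_apply,
        fourier_add, mul_re, mul_im]
      ring
    rw [this]
    exact sub_mem (sub_mem (sub_mem (mul_mul_mem_phaseSpace ra rb rc)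
      (mul_mul_mem_phaseSpace ia ib rc)) (mul_mul_mem_phaseSpace ia rb ic))
      (mul_mul_mem_phaseSpace ra ib ic)
  · have : imPart (fourier (a + b + c)) =
        imPart (fourier a) * rePart (fourier b) * rePart (fourier c) +
          rePart (fourier a) * imPart (fourier b) * rePart (fourier c) +
          rePart (fourier a) * rePart (fourier b) * imPart (fourier c) -
          imPart (fourier a) * imPart (fourier b) * imPart (fourier c) := by
      ext x
      simp only [rePart_apply, imPart_apply, ContinuousMap.sub_apply, ContinuousMap.add_apply,
        ContinuousMap.mul_apply, fourier_add, mul_re, mul_im]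
      ring
    rw [this]
    exact sub_mem (add_mem (add_mem (mul_mul_mem_phaseSpace ia rb rc)
      (mul_mul_mem_phaseSpace ra ib rc)) (mul_mul_mem_phaseSpace ra rb ic))
      (mul_mul_mem_phaseSpace ia ib ic)

lemma fourier_neg_mem_phaseSpace {k : ℤ}
    (h : rePart (fourier k) ∈ phaseSpace α Q ∧ imPart (fourier k) ∈ phaseSpace α Q) :
    rePart (fourier (-k)) ∈ phaseSpace α Q ∧ imPart (fourier (-k)) ∈ phaseSpace α Q := by
  have h1 : rePart (fourier (-k)) = rePart (fourier k) := by
    ext x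
    simp only [rePart_apply, fourier_neg, conj_re]
  have h2 : imPart (fourier (-k)) = -imPart (fourier k) := by
    ext x
    simp only [imPart_apply, fourier_neg, conj_im, ContinuousMap.neg_apply]
  rw [h1, h2]
  exact ⟨h.1, neg_mem h.2⟩

/-! ### Complexification and density -/

variable (α Q) in
/-- The complexification of `phaseSpace`. -/
def complexPhaseSpace : Submodule ℂ C(Torus, ℂ) where
  carrier := {F | rePart F ∈ phaseSpace α Q ∧ imPart F ∈ phaseSpace α Q}
  add_mem' := fun {F G} hF hG => by
    have e1 : rePart (F + G) = rePart F + rePart G := by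
      ext x; simp
    have e2 : imPart (F + G) = imPart F + imPart G := by
      ext x; simp
    rw [Set.mem_ofPred_eq, e1, e2]
    exact ⟨add_mem hF.1 hG.1, add_mem hF.2 hG.2⟩
  zero_mem' := by
    have e1 : rePart 0 = 0 := by
      ext x; simp
    have e2 : imPart 0 = 0 := by
      ext x; simp
    rw [Set.mem_ofPred_eq, e1, e2]
    exact ⟨zero_mem _, zero_mem _⟩
  smul_mem' := fun c F hF => by
    have e1 : rePart (c • F) = c.re • rePart F - c.im • imPart F := by
      ext x; simp
    have e2 : imPart (c • F) = c.re • imPart F + c.im • rePart F := by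
      ext x; simp
    rw [Set.mem_ofPred_eq, e1, e2]
    exact ⟨sub_mem (Submodule.smul_mem _ _ hF.1) (Submodule.smul_mem _ _ hF.2),
      add_mem (Submodule.smul_mem _ _ hF.2) (Submodule.smul_mem _ _ hF.1)⟩

lemma isClosed_complexPhaseSpace : IsClosed (complexPhaseSpace α Q : Set C(Torus, ℂ)) :=
  (isClosed_phaseSpace.preimage (ContinuousMap.continuous_postcomp _)).inter
    (isClosed_phaseSpace.preimage (ContinuousMap.continuous_postcomp _))

lemma phaseSpace_eq_top
    (hspan : ({fun _ => 1, fun x => Real.sin x, fun x => Real.cos x,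
        fun x => Real.sin (2 * x), fun x => Real.cos (2 * x)} : Set (ℝ → ℝ)) ⊆
      (Submodule.span ℝ (Set.range fun (j : Fin q) (x : ℝ) => Q j (x : Torus)) :
        Set (ℝ → ℝ))) (θ : C(Torus, ℝ)) : θ ∈ phaseSpace α Q := by
  have h0 : rePart (fourier 0) ∈ phaseSpace α Q ∧ imPart (fourier 0) ∈ phaseSpace α Q := by
    constructor <;> refine mem_phaseSpace_of_span ?_
    · simp only [rePart_fourier_coe, Int.cast_zero, zero_mul, Real.cos_zero]
      exact hspan (by simp)
    · simp only [imPart_fourier_coe, Int.cast_zero, zero_mul, Real.sin_zero]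
      exact zero_mem _
  have h1 : rePart (fourier 1) ∈ phaseSpace α Q ∧ imPart (fourier 1) ∈ phaseSpace α Q := by
    constructor <;> refine mem_phaseSpace_of_span ?_
    · simp only [rePart_fourier_coe, Int.cast_one, one_mul]
      exact hspan (by simp)
    · simp only [imPart_fourier_coe, Int.cast_one, one_mul]
      exact hspan (by simp)
  have h2 : rePart (fourier 2) ∈ phaseSpace α Q ∧ imPart (fourier 2) ∈ phaseSpace α Q := by
    constructor <;> refine mem_phaseSpace_of_span ?_
    · simp only [rePart_fourier_coe, Int.cast_ofNat]
      exact hspan (by simp)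
    · simp only [imPart_fourier_coe, Int.cast_ofNat]
      exact hspan (by simp)
  have hnat : ∀ n : ℕ, rePart (fourier n) ∈ phaseSpace α Q ∧
      imPart (fourier n) ∈ phaseSpace α Q := by
    intro n
    induction n with
    | zero => exact_mod_cast h0
    | succ n ih =>
      rcases Nat.eq_zero_or_pos n with rfl | hn
      · simpa using h1
      -- Here `n + 1 = n + 2 - 1` uses three nonzero frequencies, so `n = 0` is treated apart.
      -- Frequency 2 is essential: sums of three odd frequencies stay odd.
      · have := fourier_add_mem_phaseSpace (a := n) (b := 2) (c := -1) (by omega) (by norm_num)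
          (by norm_num) ih h2 (fourier_neg_mem_phaseSpace h1)
        rwa [show (n : ℤ) + 2 + -1 = ((n + 1 : ℕ) : ℤ) by push_cast; ring] at this
  have hint : ∀ k : ℤ, rePart (fourier k) ∈ phaseSpace α Q ∧
      imPart (fourier k) ∈ phaseSpace α Q := by
    intro k
    obtain ⟨n, rfl | rfl⟩ := k.eq_nat_or_neg
    · exact hnat n
    · exact fourier_neg_mem_phaseSpace (hnat n)
  have hle : (Submodule.span ℂ (Set.range (@fourier (2 * Real.pi)))).topologicalClosure ≤
      complexPhaseSpace α Q := by
    refine Submodule.topologicalClosure_minimal _ (Submodule.span_le.2 ?_)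
      isClosed_complexPhaseSpace
    rintro _ ⟨k, rfl⟩
    exact hint k
  rw [span_fourier_closure_eq_top] at hle
  have hθ : rePart (toC θ) ∈ phaseSpace α Q := (hle (Submodule.mem_top (x := toC θ))).1
  exact hθ

end KdVSch

end

/-- Small-time approximate control of phases, in `L²(𝕋)`, for
`∂ₜψ + ∂ₓ³ψ - iα ∂ₓ²ψ = i (u · Q) ψ` with piecewise constant controls `u`. The solution associated
with `u` is asserted to exist and to be unique on `[0,T]`. -/
theorem theorem3p4 (α : ℝ) (q : ℕ) (Q : Fin q → C(KdVSch.Torus, ℝ))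
    (hQ : ∀ j, KdVSch.IsSmooth (Q j))
    (hspan : ({fun _ => 1, fun x => Real.sin x, fun x => Real.cos x,
        fun x => Real.sin (2 * x), fun x => Real.cos (2 * x)} : Set (ℝ → ℝ)) ⊆
      (Submodule.span ℝ (Set.range fun (j : Fin q) (x : ℝ) => Q j (x : KdVSch.Torus)) :
        Set (ℝ → ℝ)))
    (ψ₀ : KdVSch.L2) (ε : ℝ) (hε : 0 < ε)
    (θ : C(KdVSch.Torus, ℝ)) (hθ : KdVSch.IsSmooth θ) :
    ∃ T : ℝ, 0 < T ∧ T < ε ∧ ∃ u : ℝ → Fin q → ℝ, KdVSch.IsPWC T u ∧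
      ∃ ψ : ℝ → KdVSch.L2, KdVSch.IsSolution α Q T u ψ₀ ψ ∧
        (∀ χ : ℝ → KdVSch.L2, KdVSch.IsSolution α Q T u ψ₀ χ → Set.EqOn χ ψ (Set.Icc 0 T)) ∧
        ‖ψ T - KdVSch.mulL2 (KdVSch.phase θ) ψ₀‖ < ε := by
  obtain ⟨T, hT, hTε, ψ₁, ⟨u, hp, hb, ψ, hψ, rfl⟩, hn⟩ :=
    KdVSch.phaseSpace_eq_top (α := α) hspan θ 1 ψ₀ ε hε
  rw [one_smul] at hn
  exact ⟨T, hT, hTε, u, hp, ψ, hψ, fun χ hχ => hψ.eqOn hb hχ, hn⟩
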